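/- Let $n\ge 0$. An $n$-qubit Pauli string is a tensor product of $n$ matrices from $\{I,X,Y,Z\}$; a signed Pauli string is $\pm$ a Pauli string. The $n$-qubit Pauli group $\mathcal P_n$ is generated by the Pauli strings with phases $\pm1,\pm i$. A stabilizer group is an Abelian subgroup of $\mathcal P_n$ that does not contain $-\mathbb 1$; if its rank (minimal number of generators) is $n$, it has a unique common $+1$ eigenstate $|\psi\rangle\langle\psi|$, called a pure stabilizer state. Let $\mathrm{STAB}_n$ be the convex hull of all pure stabilizer states. For a finite set $\mathcal M$ of $m$ signed $n$-qubit Pauli strings let $$\mathrm{STAB}(\mathcal M)=\{(\mathrm{tr}(P\rho))_{P\in\mathcal M} : \rho\in\mathrm{STAB}_n\}\subseteq\mathbb R^{\mathcal M}.$$ Let $G_{\mathcal M}$ be the frustration graph of $\mathcal M$: its vertices are the elements of $\mathcal M$ and its edges are the anticommuting pairs. Let $I_{\max}(G_{\mathcal M})$ be the set of its inclusion-maximal independent sets. For $S\in I_{\max}(G_{\mathcal M})$ let $$B_S=\Big\{f\in\{\pm1\}^S : \prod_{P\in S'}f_P P\neq-\mathbb 1\ \text{ for all } S'\subseteq S\Big\},$$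 and for $f\in B_S$ let $v_{S,f}\in\mathbb R^{\mathcal M}$ be the vector with $(v_{S,f})_P=f_P$ if $P\in S$ and $(v_{S,f})_P=0$ otherwise. Put $\mathrm{stab}(\mathcal M)=\{v_{S,f} : S\in I_{\max}(G_{\mathcal M}),\ f\in B_S\}$. **Theorem.** (1) For all $n$ and $\mathcal M$ as above, $\mathrm{STAB}(\mathcal M)=\mathrm{conv}\,\mathrm{stab}(\mathcal M)$, and $\mathrm{stab}(\mathcal M)$ is exactly the set of extreme points of $\mathrm{STAB}(\mathcal M)$. (2) Let $c=\tfrac13\log_2 3$. There is a sequence $\varepsilon(n)\to0$ $(n\to\infty)$, not depending on $\mathcal M$, such that: (a) for all $n$ and $\mathcal M$ as above, with $m=|\mathcal M|$, the set $\mathrm{stab}(\mathcal M)$ is finite and $$|\mathrm{stab}(\mathcal M)|\le 2^{\min\{n,m\}+\min\{cm,\ (1/2+\varepsilon(n))n^2\}};$$ (b) for every $n$, the set $\mathcal M=\bigcup_{i=1}^n\{X_i,Y_i,Z_i\}$ of all single-site Pauli operators on $n$ qubits, where $m=3n$, attains this bound with equality, and $|\mathrm{stab}(\mathcal M)|=2^{n+cm}=6^n$.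 -/

import Mathlib

open Filter Topology

noncomputable section

/-- Operators on `n` qubits, as matrices in the computational basis `{0,1}^n`. -/
abbrev QubitOp (n : ℕ) : Type := Matrix (Fin n → Fin 2) (Fin n → Fin 2) ℂ

/-- Labels of the four single-qubit Pauli operators. -/
inductive PauliLabel : Type
  | I
  | X
  | Y
  | Z

/-- The single-qubit Pauli matrices. -/
def pauliMatrix : PauliLabel → Matrix (Fin 2) (Fin 2) ℂ
  | .I => 1
  | .X => !![0, 1; 1, 0]
  | .Y => !![0, -Complex.I; Complex.I, 0]
  | .Z => !![1, 0; 0, -1]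

/-- The tensor product `σ_{s 1} ⊗ ⋯ ⊗ σ_{s n}` of single-qubit Pauli matrices. -/
def pauliString {n : ℕ} (s : Fin n → PauliLabel) : QubitOp n :=
  Matrix.of fun x y => ∏ i, pauliMatrix (s i) (x i) (y i)

/-- A Pauli observable: a Pauli string up to a sign. -/
def IsPauliObservable {n : ℕ} (P : QubitOp n) : Prop :=
  ∃ s : Fin n → PauliLabel, P = pauliString s ∨ P = -pauliString s

/-- The `n`-qubit Pauli group: generated by the tensor products of single-qubit Pauli operators
with overall phases `±1, ±i`. -/
def pauliGroup (n : ℕ) : Subgroup (QubitOp n)ˣ :=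
  Subgroup.closure
    {u | ∃ (c : ℂ) (s : Fin n → PauliLabel), c ^ 4 = 1 ∧ (u : QubitOp n) = c • pauliString s}

/-- A stabilizer group: an Abelian subgroup of the Pauli group that does not contain `-1`. -/
structure IsStabilizerGroup {n : ℕ} (S : Subgroup (QubitOp n)ˣ) : Prop where
  le_pauliGroup : S ≤ pauliGroup n
  comm : ∀ a ∈ S, ∀ b ∈ S, a * b = b * a
  neg_one_notMem : (-1 : (QubitOp n)ˣ) ∉ S

/-- The pure stabilizer states, as density matrices: `|ψ⟩⟨ψ|`, where `ψ` is a unit vector fixed by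
all elements of a stabilizer group of rank `n`. -/
def IsPureStabilizerState {n : ℕ} (ρ : QubitOp n) : Prop :=
  ∃ S : Subgroup (QubitOp n)ˣ, IsStabilizerGroup S ∧ (∃ _ : Group.FG S, Group.rank S = n) ∧
    ∃ ψ : (Fin n → Fin 2) → ℂ, star ψ ⬝ᵥ ψ = 1 ∧
      (∀ s ∈ S, (s : QubitOp n).mulVec ψ = ψ) ∧ ρ = Matrix.vecMulVec ψ (star ψ)

/-- The stabilizer polytope: mixtures of pure stabilizer states. -/
def stabilizerPolytope (n : ℕ) : Set (QubitOp n) :=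
  convexHull ℝ {ρ | IsPureStabilizerState ρ}

/-- The vector of expectation values `⟨P⟩_ρ = tr (P ρ)`, `P ∈ M`.  (These are real numbers when
`P` and `ρ` are Hermitian.) -/
def expectationVector {n : ℕ} (M : Finset (QubitOp n)) (ρ : QubitOp n) : M → ℝ :=
  fun P => ((P : QubitOp n) * ρ).trace.re

/-- The projection of the stabilizer polytope onto the expectation values of `M`. -/
def reducedPolytope {n : ℕ} (M : Finset (QubitOp n)) : Set (M → ℝ) :=
  expectationVector M '' stabilizerPolytope n

/-- The frustration graph of `M`: the vertices are the elements of `M`, and the edges are the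
anticommuting pairs. -/
def frustrationGraph {n : ℕ} (M : Finset (QubitOp n)) : SimpleGraph M where
  Adj P Q := P ≠ Q ∧ (P : QubitOp n) * (Q : QubitOp n) = -((Q : QubitOp n) * (P : QubitOp n))
  symm := ⟨fun P Q h => ⟨h.1.symm, by rw [h.2, neg_neg]⟩⟩
  loopless := ⟨fun _ h => h.1 rfl⟩

/-- The maximal (with respect to inclusion) independent sets of the frustration graph. -/
def maxIndepSets {n : ℕ} (M : Finset (QubitOp n)) : Set (Set M) :=
  {S | Maximal (frustrationGraph M).IsIndepSet S}

/-- The sign assignments `f` on `S` such that no product of the signed operators `f_P P` over a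
subset of `S` equals `-1`.  A subset of `S` is listed as a duplicate-free list; when the elements
of `S` commute, as on an independent set of Pauli observables, the product does not depend on the
order of the list. -/
def admissibleSigns {n : ℕ} {M : Finset (QubitOp n)} (S : Set M) : Set (S → ℤˣ) :=
  {f | ∀ l : List S, l.Nodup →
    (l.map fun P => ((f P : ℤ) : ℂ) • ((P : M) : QubitOp n)).prod ≠ -1}

open Classical in
/-- The vector with entry `f_P` at `P ∈ S`, and `0` at the other elements of `M`. -/
def signVector {n : ℕ} {M : Finset (QubitOp n)} (S : Set M) (f : S → ℤˣ) : M → ℝ :=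
  fun P => if h : P ∈ S then ((f ⟨P, h⟩ : ℤ) : ℝ) else 0

/-- The set of all vectors `v_{S,f}`, `S` a maximal independent set, `f` admissible on `S`. -/
def stabVectors {n : ℕ} (M : Finset (QubitOp n)) : Set (M → ℝ) :=
  {v | ∃ S ∈ maxIndepSets M, ∃ f ∈ admissibleSigns S, v = signVector S f}

/-- The single-qubit Pauli operator with label `a`, acting on qubit `i`. -/
def localPauli {n : ℕ} (i : Fin n) (a : PauliLabel) : QubitOp n :=
  pauliString (Function.update (fun _ => PauliLabel.I) i a)

open Classical in
/-- The set of all `X_i`, `Y_i`, `Z_i`, where `i` runs over the `n` qubits. -/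
def localPaulis (n : ℕ) : Finset (QubitOp n) :=
  Finset.univ.biUnion fun i : Fin n => {localPauli i .X, localPauli i .Y, localPauli i .Z}

end

noncomputable section

/-- The Pauli label with given `X` and `Z` exponents. -/
def labelOfBits (b : ZMod 2 × ZMod 2) : PauliLabel :=
  if b.1 = 0 then (if b.2 = 0 then .I else .Z) else (if b.2 = 0 then .X else .Y)

lemma labelOfBits_surjective : Function.Surjective labelOfBits := by
  intro a
  cases a
  · exact ⟨(0, 0), by simp [labelOfBits]⟩
  · exact ⟨(1, 0), by simp [labelOfBits]⟩
  · exact ⟨(1, 1), by simp [labelOfBits]⟩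
  · exact ⟨(0, 1), by simp [labelOfBits]⟩

/-- The Pauli string with given exponent vector. -/
def pauliOf {n : ℕ} (v : Fin n → ZMod 2 × ZMod 2) : QubitOp n :=
  pauliString fun i => labelOfBits (v i)

lemma exists_pauliOf {n : ℕ} (s : Fin n → PauliLabel) : ∃ v, pauliString s = pauliOf v := by
  choose g hg using labelOfBits_surjective
  exact ⟨fun i => g (s i), by simp [pauliOf, hg]⟩

lemma pauliString_mul_apply {n : ℕ} (s t : Fin n → PauliLabel) (x y : Fin n → Fin 2) :
    (pauliString s * pauliString t) x y
      = ∏ i, (pauliMatrix (s i) * pauliMatrix (t i)) (x i) (y i) := by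
  simp only [Matrix.mul_apply, pauliString, Matrix.of_apply, ← Finset.prod_mul_distrib]
  rw [Finset.prod_univ_sum]
  simp

lemma zmod_two_pair_cases (b : ZMod 2 × ZMod 2) :
    b = (0, 0) ∨ b = (0, 1) ∨ b = (1, 0) ∨ b = (1, 1) := by
  revert b; decide

lemma zmod_two_one_add_one : (1 + 1 : ZMod 2) = 0 := by decide

/-- The commutation character of two single-qubit Pauli operators. -/
def bitsForm (a b : ZMod 2 × ZMod 2) : ZMod 2 := a.1 * b.2 + a.2 * b.1

/-- The nontrivial character of `ZMod 2`. -/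
def zmodSign (a : ZMod 2) : ℂ := if a = 0 then 1 else -1

lemma zmodSign_add (a b : ZMod 2) : zmodSign (a + b) = zmodSign a * zmodSign b := by
  have h : ∀ c : ZMod 2, c = 0 ∨ c = 1 := by decide
  rcases h a with rfl | rfl <;> rcases h b with rfl | rfl <;>
    simp [zmodSign, zmod_two_one_add_one]

lemma zmodSign_sum {ι : Type*} (s : Finset ι) (f : ι → ZMod 2) :
    zmodSign (∑ i ∈ s, f i) = ∏ i ∈ s, zmodSign (f i) := by
  classical
  induction s using Finset.induction_on with
  | empty => simp [zmodSign]
  | insert a s ha ih => rw [Finset.sum_insert ha, Finset.prod_insert ha, zmodSign_add, ih]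

lemma pauliMatrix_mul (a b : ZMod 2 × ZMod 2) : ∃ c : ℂ, c ^ 4 = 1 ∧
    pauliMatrix (labelOfBits a) * pauliMatrix (labelOfBits b)
      = c • pauliMatrix (labelOfBits (a + b)) := by
  have hI : (-Complex.I) ^ 4 = 1 := by rw [Even.neg_pow (by decide), Complex.I_pow_four]
  rcases zmod_two_pair_cases a with rfl | rfl | rfl | rfl <;>
  rcases zmod_two_pair_cases b with rfl | rfl | rfl | rfl <;>
  first
  | refine ⟨1, by simp, ?_⟩
    simp [labelOfBits, pauliMatrix, Matrix.one_fin_two, zmod_two_one_add_one]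
    done
  | refine ⟨Complex.I, by simp, ?_⟩
    simp [labelOfBits, pauliMatrix, zmod_two_one_add_one]
    done
  | refine ⟨-Complex.I, hI, ?_⟩
    simp [labelOfBits, pauliMatrix, zmod_two_one_add_one]

lemma pauliMatrix_mul_comm (a b : ZMod 2 × ZMod 2) :
    pauliMatrix (labelOfBits a) * pauliMatrix (labelOfBits b)
      = zmodSign (bitsForm a b) •
        (pauliMatrix (labelOfBits b) * pauliMatrix (labelOfBits a)) := by
  rcases zmod_two_pair_cases a with rfl | rfl | rfl | rfl <;>
  rcases zmod_two_pair_cases b with rfl | rfl | rfl | rfl <;>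
    simp [labelOfBits, pauliMatrix, Matrix.one_fin_two, zmod_two_one_add_one, bitsForm, zmodSign]

lemma pauliMatrix_sq (a : PauliLabel) : pauliMatrix a * pauliMatrix a = 1 := by
  cases a <;> simp [pauliMatrix, Matrix.one_fin_two]

lemma star_pauliMatrix_apply (a : PauliLabel) (x y : Fin 2) :
    star (pauliMatrix a x y) = pauliMatrix a y x := by
  cases a <;> fin_cases x <;> fin_cases y <;> simp [pauliMatrix]

/-- The commutation character of two Pauli strings. -/
def stringForm {n : ℕ} (u v : Fin n → ZMod 2 × ZMod 2) : ZMod 2 := ∑ i, bitsForm (u i) (v i)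

lemma pauliOf_mul {n : ℕ} (u v : Fin n → ZMod 2 × ZMod 2) : ∃ c : ℂ, c ^ 4 = 1 ∧
    pauliOf u * pauliOf v = c • pauliOf (u + v) := by
  choose c hc h using fun i => pauliMatrix_mul (u i) (v i)
  refine ⟨∏ i, c i, by simp [← Finset.prod_pow, hc], ?_⟩
  ext x y
  simp only [pauliOf, pauliString_mul_apply, h]
  simp [pauliString, Finset.prod_mul_distrib]

lemma pauliOf_mul_comm {n : ℕ} (u v : Fin n → ZMod 2 × ZMod 2) :
    pauliOf u * pauliOf v = zmodSign (stringForm u v) • (pauliOf v * pauliOf u) := by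
  ext x y
  simp only [pauliOf, pauliString_mul_apply, pauliMatrix_mul_comm (u _) (v _), Matrix.smul_apply,
    stringForm, zmodSign_sum, smul_eq_mul, Finset.prod_mul_distrib]

lemma pauliString_sq {n : ℕ} (s : Fin n → PauliLabel) : pauliString s * pauliString s = 1 := by
  ext x y
  rw [pauliString_mul_apply]
  simp only [pauliMatrix_sq, Matrix.one_apply, Finset.prod_ite_zero, Finset.prod_const_one]
  simp [funext_iff]

lemma pauliString_conjTranspose {n : ℕ} (s : Fin n → PauliLabel) :
    (pauliString s).conjTranspose = pauliString s := by
  ext x y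
  simp only [Matrix.conjTranspose_apply, pauliString, Matrix.of_apply, star_prod,
    star_pauliMatrix_apply]

lemma pauliOf_sq {n : ℕ} (v : Fin n → ZMod 2 × ZMod 2) : pauliOf v * pauliOf v = 1 :=
  pauliString_sq _

lemma pauliOf_conjTranspose {n : ℕ} (v : Fin n → ZMod 2 × ZMod 2) :
    (pauliOf v).conjTranspose = pauliOf v :=
  pauliString_conjTranspose _

lemma pauliOf_zero {n : ℕ} : pauliOf (0 : Fin n → ZMod 2 × ZMod 2) = 1 := by
  ext x y
  simp only [pauliOf, pauliString, Matrix.of_apply, labelOfBits, Pi.zero_apply, Prod.fst_zero,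
    Prod.snd_zero, if_true, pauliMatrix, Matrix.one_apply, Finset.prod_ite_zero,
    Finset.prod_const_one]
  simp [funext_iff]

lemma trace_pauliOf {n : ℕ} {v : Fin n → ZMod 2 × ZMod 2} (hv : v ≠ 0) :
    (pauliOf v).trace = 0 := by
  obtain ⟨j, hj⟩ := Function.ne_iff.1 hv
  have h : (pauliOf v).trace = ∏ i, ∑ x, pauliMatrix (labelOfBits (v i)) x x := by
    rw [Finset.prod_univ_sum]
    simp [Matrix.trace, pauliOf, pauliString]
  rw [h]
  refine Finset.prod_eq_zero (Finset.mem_univ j) ?_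
  rcases zmod_two_pair_cases (v j) with h | h | h | h <;>
    simp_all [labelOfBits, pauliMatrix]

lemma sum_pauliMatrix_mul (x y z w : Fin 2) :
    ∑ b : ZMod 2 × ZMod 2, pauliMatrix (labelOfBits b) x y * pauliMatrix (labelOfBits b) z w
      = 2 * if x = w ∧ y = z then 1 else 0 := by
  have h : (Finset.univ : Finset (ZMod 2 × ZMod 2)) = {(0, 0), (0, 1), (1, 0), (1, 1)} := by
    decide
  rw [h]
  fin_cases x <;> fin_cases y <;> fin_cases z <;> fin_cases w <;>
    simp [labelOfBits, pauliMatrix] <;> norm_num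

lemma sum_pauliOf_mul {n : ℕ} (x y z w : Fin n → Fin 2) :
    ∑ v : Fin n → ZMod 2 × ZMod 2, pauliOf v x y * pauliOf v z w
      = 2 ^ n * if x = w ∧ y = z then 1 else 0 := by
  have h : ∑ v : Fin n → ZMod 2 × ZMod 2, pauliOf v x y * pauliOf v z w
      = ∏ i, ∑ b : ZMod 2 × ZMod 2,
        pauliMatrix (labelOfBits b) (x i) (y i) * pauliMatrix (labelOfBits b) (z i) (w i) := by
    rw [Finset.prod_univ_sum]
    simp [pauliOf, pauliString, Finset.prod_mul_distrib]
  rw [h]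
  simp only [sum_pauliMatrix_mul, Finset.prod_mul_distrib, Finset.prod_ite_zero]
  simp [funext_iff, forall_and]

lemma pauliOf_injective_up_to_phase {n : ℕ} {u v : Fin n → ZMod 2 × ZMod 2} {c d : ℂ}
    (hd : d ≠ 0) (h : c • pauliOf u = d • pauliOf v) : u = v := by
  by_contra huv
  have h2 : (2 : Fin n → ZMod 2 × ZMod 2) = 0 := by
    ext i <;> exact (by decide : (2 : ZMod 2) = 0)
  have huv' : u + v ≠ 0 := by
    intro h0
    apply huv
    have : v + v = 0 := by rw [← two_mul, h2, zero_mul]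
    exact add_right_cancel (h0.trans this.symm)
  obtain ⟨e, he, hm⟩ := pauliOf_mul u v
  have h1 := congrArg (fun A => (A * pauliOf v).trace) h
  simp only [Matrix.smul_mul, hm, Matrix.trace_smul, trace_pauliOf huv', pauliOf_sq,
    Matrix.trace_one, smul_eq_mul] at h1
  simp [hd] at h1

lemma exists_of_mem_pauliGroup {n : ℕ} {g : (QubitOp n)ˣ} (hg : g ∈ pauliGroup n) :
    ∃ (c : ℂ) (v : Fin n → ZMod 2 × ZMod 2), c ^ 4 = 1 ∧ (g : QubitOp n) = c • pauliOf v := by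
  induction hg using Subgroup.closure_induction with
  | mem x hx =>
    obtain ⟨c, s, hc, h⟩ := hx
    obtain ⟨v, hv⟩ := exists_pauliOf s
    exact ⟨c, v, hc, hv ▸ h⟩
  | one => exact ⟨1, 0, by simp, by simp [pauliOf_zero]⟩
  | mul x y _ _ hx hy =>
    obtain ⟨c, u, hc, hx⟩ := hx
    obtain ⟨d, v, hd, hy⟩ := hy
    obtain ⟨e, he, h⟩ := pauliOf_mul u v
    refine ⟨c * d * e, u + v, by simp [mul_pow, hc, hd, he], ?_⟩
    simp only [Units.val_mul, hx, hy, Matrix.smul_mul, Matrix.mul_smul, h, smul_smul]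
    congr 1; ring
  | inv x _ hx =>
    obtain ⟨c, u, hc, hx⟩ := hx
    have hc0 : c ≠ 0 := by rintro rfl; simp at hc
    refine ⟨c⁻¹, u, by simp [hc], ?_⟩
    apply Units.inv_eq_of_mul_eq_one_right
    simp [hx, pauliOf_sq, smul_smul, hc0]

lemma finite_pauliGroup (n : ℕ) : (pauliGroup n : Set (QubitOp n)ˣ).Finite := by
  have hfin : ({1, -1, Complex.I, -Complex.I} : Set ℂ).Finite := Set.toFinite _
  refine Set.Finite.of_injOn (f := fun g : (QubitOp n)ˣ => (g : QubitOp n)) (fun g hg => ?_)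
    (Units.val_injective.injOn)
    (Set.Finite.image2 (fun c (v : Fin n → ZMod 2 × ZMod 2) => c • pauliOf v) hfin Set.finite_univ)
  obtain ⟨c, v, hc, h⟩ := exists_of_mem_pauliGroup hg
  refine ⟨c, ?_, v, trivial, h.symm⟩
  have : (c - 1) * ((c + 1) * ((c - Complex.I) * (c + Complex.I))) = 0 := by
    linear_combination hc - (c ^ 2 - 1) * Complex.I_sq
  simp only [mul_eq_zero, sub_eq_zero, add_eq_zero_iff_eq_neg] at this
  simpa using this

lemma IsStabilizerGroup.exists_pauliOf {n : ℕ} {S : Subgroup (QubitOp n)ˣ}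
    (hS : IsStabilizerGroup S) {g : (QubitOp n)ˣ} (hg : g ∈ S) :
    ∃ v, (g : QubitOp n) = pauliOf v ∨ (g : QubitOp n) = -pauliOf v := by
  obtain ⟨c, v, hc, h⟩ := exists_of_mem_pauliGroup (hS.le_pauliGroup hg)
  have hgg : ((g * g : (QubitOp n)ˣ) : QubitOp n) = (c * c) • (1 : QubitOp n) := by
    simp [h, pauliOf_sq, smul_smul]
  have h4 : (c * c) * (c * c) = 1 := by rw [← hc]; ring
  rcases mul_self_eq_one_iff.1 h4 with h2 | h2
  · rcases mul_self_eq_one_iff.1 h2 with rfl | rfl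
    · exact ⟨v, Or.inl (by simpa using h)⟩
    · exact ⟨v, Or.inr (by simpa using h)⟩
  · refine absurd (S.mul_mem hg hg) ?_
    have : g * g = -1 := Units.ext (by rw [hgg, h2]; simp)
    rw [this]
    exact hS.neg_one_notMem

lemma IsStabilizerGroup.mul_self {n : ℕ} {S : Subgroup (QubitOp n)ˣ}
    (hS : IsStabilizerGroup S) {g : (QubitOp n)ˣ} (hg : g ∈ S) : g * g = 1 := by
  obtain ⟨v, h | h⟩ := hS.exists_pauliOf hg <;>
  · apply Units.ext
    simp [h, pauliOf_sq]

lemma IsStabilizerGroup.conjTranspose {n : ℕ} {S : Subgroup (QubitOp n)ˣ}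
    (hS : IsStabilizerGroup S) {g : (QubitOp n)ˣ} (hg : g ∈ S) :
    (g : QubitOp n).conjTranspose = g := by
  obtain ⟨v, h | h⟩ := hS.exists_pauliOf hg <;> simp [h, pauliOf_conjTranspose]

lemma IsStabilizerGroup.finite {n : ℕ} {S : Subgroup (QubitOp n)ˣ}
    (hS : IsStabilizerGroup S) : Finite S :=
  ((finite_pauliGroup n).subset hS.le_pauliGroup).to_subtype

/-- The exponent vectors of the elements of a subgroup, up to sign. -/
def exponents {n : ℕ} (S : Subgroup (QubitOp n)ˣ) : Set (Fin n → ZMod 2 × ZMod 2) :=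
  {v | ∃ g ∈ S, (g : QubitOp n) = pauliOf v ∨ (g : QubitOp n) = -pauliOf v}

lemma IsStabilizerGroup.card_eq_ncard_exponents {n : ℕ} {S : Subgroup (QubitOp n)ˣ}
    (hS : IsStabilizerGroup S) : Nat.card S = (exponents S).ncard := by
  choose f hf using fun g : S => hS.exists_pauliOf g.2
  rw [← Nat.card_coe_set_eq]
  refine Nat.card_eq_of_bijective (fun g : S => (⟨f g, g, g.2, hf g⟩ : exponents S)) ⟨?_, ?_⟩
  · intro g h hgh
    have hgh : f g = f h := congrArg Subtype.val hgh
    have h1 := hf g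
    have h2 := hf h
    rw [← hgh] at h2
    have : ((g : (QubitOp n)ˣ) : QubitOp n) = (h : (QubitOp n)ˣ) ∨
        ((g : (QubitOp n)ˣ) : QubitOp n) = -(h : (QubitOp n)ˣ) := by
      rcases h1 with h1 | h1 <;> rcases h2 with h2 | h2 <;> simp [h1, h2]
    rcases this with h3 | h3
    · exact Subtype.ext (Units.ext h3)
    · refine absurd (S.mul_mem g.2 (S.inv_mem h.2)) ?_
      have : (g : (QubitOp n)ˣ) = -h := Units.ext (by simpa using h3)
      rw [this]
      simpa using hS.neg_one_notMem
  · rintro ⟨v, g, hg, h⟩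
    refine ⟨⟨g, hg⟩, Subtype.ext ?_⟩
    have h2 := hf ⟨g, hg⟩
    simp only at h2 ⊢
    have key : ∃ c d : ℂ, d ≠ 0 ∧ c • pauliOf (f ⟨g, hg⟩) = d • pauliOf v := by
      rcases h with h | h <;> rcases h2 with h2 | h2 <;> rw [h] at h2
      · exact ⟨1, 1, by simp, by simp [h2]⟩
      · exact ⟨-1, 1, by simp, by simp [h2]⟩
      · exact ⟨1, -1, by simp, by simp [h2]⟩
      · exact ⟨-1, -1, by simp, by simp [h2]⟩
    obtain ⟨c, d, hd, h3⟩ := key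
    exact pauliOf_injective_up_to_phase hd h3

/-- The expectation value of `A` in the state vector `ψ`. -/
def expVal {n : ℕ} (ψ : (Fin n → Fin 2) → ℂ) (A : QubitOp n) : ℂ := star ψ ⬝ᵥ A.mulVec ψ

lemma trace_mul_vecMulVec {n : ℕ} (ψ : (Fin n → Fin 2) → ℂ) (A : QubitOp n) :
    (A * Matrix.vecMulVec ψ (star ψ)).trace = expVal ψ A := by
  rw [Matrix.mul_vecMulVec, Matrix.trace_vecMulVec, dotProduct_comm]
  rfl

lemma star_dotProduct_mulVec_comm {n : ℕ} {A : QubitOp n} (hA : A.conjTranspose = A)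
    (φ ψ : (Fin n → Fin 2) → ℂ) :
    star (A.mulVec φ) ⬝ᵥ ψ = star φ ⬝ᵥ A.mulVec ψ := by
  rw [Matrix.star_mulVec, hA, Matrix.dotProduct_mulVec]

lemma expVal_re {n : ℕ} (ψ : (Fin n → Fin 2) → ℂ) {A : QubitOp n} (hA : A.conjTranspose = A) :
    ((expVal ψ A).re : ℂ) = expVal ψ A := by
  rw [← Complex.conj_eq_iff_re, expVal, ← Complex.star_def,
    ← Matrix.star_dotProduct (A.mulVec ψ) ψ, star_dotProduct_mulVec_comm hA]

lemma expVal_of_mulVec {n : ℕ} {ψ : (Fin n → Fin 2) → ℂ} {A : QubitOp n} {c : ℂ}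
    (h : A.mulVec ψ = c • ψ) : expVal ψ A = c * (star ψ ⬝ᵥ ψ) := by
  simp [expVal, h]

lemma sum_expVal_sq {n : ℕ} (ψ : (Fin n → Fin 2) → ℂ) :
    ∑ v, expVal ψ (pauliOf v) ^ 2 = 2 ^ n * (star ψ ⬝ᵥ ψ) ^ 2 := by
  have h : ∀ v, expVal ψ (pauliOf v) ^ 2 = ∑ x, ∑ y, ∑ z, ∑ w,
      (star ψ x * ψ y * (star ψ z * ψ w)) * (pauliOf v x y * pauliOf v z w) := by
    intro v
    have : expVal ψ (pauliOf v) = ∑ x, ∑ y, star ψ x * ψ y * pauliOf v x y := by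
      simp only [expVal, dotProduct, Matrix.mulVec, Finset.mul_sum]
      refine Finset.sum_congr rfl fun x _ => Finset.sum_congr rfl fun y _ => by ring
    rw [sq, this]
    simp only [Finset.sum_mul, Finset.mul_sum]
    refine Finset.sum_congr rfl fun x _ => Finset.sum_congr rfl fun y _ =>
      Finset.sum_congr rfl fun z _ => Finset.sum_congr rfl fun w _ => by ring
  simp only [h]
  rw [Finset.sum_comm]
  simp only [Finset.sum_comm (s := (Finset.univ : Finset (Fin n → ZMod 2 × ZMod 2))),
    ← Finset.mul_sum, sum_pauliOf_mul]
  simp only [ite_and, mul_ite, mul_one, mul_zero, Finset.sum_ite_eq, Finset.mem_univ, if_true]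
  rw [sq, dotProduct, Finset.sum_mul_sum, Finset.mul_sum]
  refine Finset.sum_congr rfl fun x _ => ?_
  rw [Finset.mul_sum]
  refine Finset.sum_congr rfl fun y _ => by ring

lemma sum_expVal_re_sq {n : ℕ} {ψ : (Fin n → Fin 2) → ℂ} (hψ : star ψ ⬝ᵥ ψ = 1) :
    ∑ v, (expVal ψ (pauliOf v)).re ^ 2 = 2 ^ n := by
  have h : ∑ v : Fin n → ZMod 2 × ZMod 2, ((expVal ψ (pauliOf v)).re : ℂ) ^ 2 = 2 ^ n := by
    rw [Finset.sum_congr rfl fun v _ => by rw [expVal_re ψ (pauliOf_conjTranspose v)],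
      sum_expVal_sq, hψ, one_pow, mul_one]
  have h2 : ((∑ v, (expVal ψ (pauliOf v)).re ^ 2 : ℝ) : ℂ) = ((2 ^ n : ℝ) : ℂ) := by
    push_cast
    exact h
  exact_mod_cast h2

lemma expVal_re_sq_of_mem_exponents {n : ℕ} {S : Subgroup (QubitOp n)ˣ}
    {ψ : (Fin n → Fin 2) → ℂ} (hψ : star ψ ⬝ᵥ ψ = 1)
    (hfix : ∀ s ∈ S, (s : QubitOp n).mulVec ψ = ψ) {v} (hv : v ∈ exponents S) :
    (expVal ψ (pauliOf v)).re ^ 2 = 1 := by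
  obtain ⟨g, hg, h | h⟩ := hv
  · rw [← h, expVal_of_mulVec (c := 1) (by simp [hfix g hg]), hψ]; simp
  · have : pauliOf v = -(g : QubitOp n) := by rw [h, neg_neg]
    rw [this, expVal_of_mulVec (c := -1) (by simp [hfix g hg, Matrix.neg_mulVec]), hψ]; simp

lemma card_add_sum_notMem_exponents {n : ℕ} {S : Subgroup (QubitOp n)ˣ}
    (hS : IsStabilizerGroup S) {ψ : (Fin n → Fin 2) → ℂ} (hψ : star ψ ⬝ᵥ ψ = 1)
    (hfix : ∀ s ∈ S, (s : QubitOp n).mulVec ψ = ψ) [DecidablePred (· ∈ exponents S)] :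
    (Nat.card S : ℝ) + ∑ v with v ∉ exponents S, (expVal ψ (pauliOf v)).re ^ 2 = 2 ^ n := by
  rw [← sum_expVal_re_sq hψ, ← Finset.sum_filter_add_sum_filter_not Finset.univ (· ∈ exponents S)
    (fun v => (expVal ψ (pauliOf v)).re ^ 2)]
  congr 1
  rw [Finset.sum_congr rfl fun v hv =>
    expVal_re_sq_of_mem_exponents hψ hfix (Finset.mem_filter.1 hv).2, Finset.sum_const,
    nsmul_one, hS.card_eq_ncard_exponents, Set.ncard_eq_toFinset_card']
  simp [Set.toFinset]

lemma expVal_re_eq_zero_of_card {n : ℕ} {S : Subgroup (QubitOp n)ˣ}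
    (hS : IsStabilizerGroup S) {ψ : (Fin n → Fin 2) → ℂ} (hψ : star ψ ⬝ᵥ ψ = 1)
    (hfix : ∀ s ∈ S, (s : QubitOp n).mulVec ψ = ψ) (hcard : Nat.card S = 2 ^ n)
    {v} (hv : v ∉ exponents S) : (expVal ψ (pauliOf v)).re = 0 := by
  classical
  have h := card_add_sum_notMem_exponents hS hψ hfix
  rw [hcard] at h
  push_cast at h
  have h0 : ∑ v with v ∉ exponents S, (expVal ψ (pauliOf v)).re ^ 2 = 0 := by linarith
  rw [Finset.sum_eq_zero_iff_of_nonneg fun _ _ => sq_nonneg _] at h0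
  exact pow_eq_zero_iff (two_ne_zero) |>.1 (h0 v (by simp [hv]))

lemma card_eq_of_expVal_re_eq_zero {n : ℕ} {S : Subgroup (QubitOp n)ˣ}
    (hS : IsStabilizerGroup S) {ψ : (Fin n → Fin 2) → ℂ} (hψ : star ψ ⬝ᵥ ψ = 1)
    (hfix : ∀ s ∈ S, (s : QubitOp n).mulVec ψ = ψ)
    (h0 : ∀ v ∉ exponents S, (expVal ψ (pauliOf v)).re = 0) : Nat.card S = 2 ^ n := by
  classical
  have h := card_add_sum_notMem_exponents hS hψ hfix
  rw [Finset.sum_eq_zero fun v hv => by rw [h0 v (Finset.mem_filter.1 hv).2]; simp, add_zero] at h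
  exact_mod_cast h

/-- If `A` anticommutes with a Hermitian operator that fixes `ψ`, its expectation value is `0`. -/
lemma expVal_eq_zero_of_anticomm {n : ℕ} {ψ : (Fin n → Fin 2) → ℂ} {A B : QubitOp n} {c : ℂ}
    (hB : B.conjTranspose = B) (hc : c ≠ 0) (hc' : star c = c) (hBψ : B.mulVec ψ = c • ψ)
    (h : A * B = -(B * A)) : expVal ψ A = 0 := by
  have h1 : c * expVal ψ A = star ψ ⬝ᵥ (A * B).mulVec ψ := by
    rw [← Matrix.mulVec_mulVec, hBψ, Matrix.mulVec_smul, dotProduct_smul, smul_eq_mul, expVal]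
  rw [h, Matrix.neg_mulVec, dotProduct_neg, ← Matrix.mulVec_mulVec,
    ← star_dotProduct_mulVec_comm hB, hBψ, star_smul, smul_dotProduct, hc', smul_eq_mul] at h1
  have h2 : c * expVal ψ A = -(c * expVal ψ A) := h1
  have h3 : c * expVal ψ A = 0 := self_eq_neg.1 h2
  exact (mul_eq_zero.1 h3).resolve_left hc

lemma card_eq_two_pow_rank {G : Type*} [Group G] [Finite G] (h : ∀ g : G, g * g = 1) :
    Nat.card G = 2 ^ Group.rank G := by
  classical
  let : CommGroup G := { ‹Group G› with
    mul_comm := fun a b => by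
      have ha : ∀ g : G, g⁻¹ = g := fun g => inv_eq_of_mul_eq_one_left (h g)
      rw [← ha (a * b), mul_inv_rev, ha, ha] }
  let : Module (ZMod 2) (Additive G) := AddCommGroup.zmodModule (n := 2) fun x => by
    rw [two_nsmul]; exact h x.toMul
  have hcard : Nat.card G = 2 ^ Module.finrank (ZMod 2) (Additive G) := by
    rw [Nat.card_congr (Additive.ofMul (α := G)),
      Module.natCard_eq_pow_finrank (K := ZMod 2) (V := Additive G), Nat.card_zmod]
  rw [hcard]
  congr 1
  apply le_antisymm
  · obtain ⟨s, hs, hc⟩ := Group.rank_spec G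
    rw [← hs]
    let t : Finset (Additive G) := s.map Additive.ofMul.toEmbedding
    have key : ∀ y ∈ Subgroup.closure (s : Set G),
        Additive.ofMul y ∈ Submodule.span (ZMod 2) (t : Set (Additive G)) := by
      intro y hy
      induction hy using Subgroup.closure_induction with
      | mem y hy => exact Submodule.subset_span (by simpa [t] using hy)
      | one => exact Submodule.zero_mem _
      | mul a b _ _ ha hb => exact Submodule.add_mem _ ha hb
      | inv a _ ha => exact Submodule.neg_mem _ ha
    have htop : Submodule.span (ZMod 2) (t : Set (Additive G)) = ⊤ := by
      rw [eq_top_iff]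
      exact fun x _ => key x.toMul (by rw [hc]; trivial)
    have h3 := finrank_span_finset_le_card (R := ZMod 2) t
    rw [Set.finrank, htop, finrank_top] at h3
    simpa [t] using h3
  · let b := Module.finBasis (ZMod 2) (Additive G)
    let t : Finset G := Finset.univ.image fun i => (b i).toMul
    have key : ∀ y ∈ Submodule.span (ZMod 2) (Set.range b),
        y.toMul ∈ Subgroup.closure (t : Set G) := by
      intro y hy
      induction hy using Submodule.span_induction with
      | mem y hy =>
        obtain ⟨i, rfl⟩ := hy
        exact Subgroup.subset_closure (Finset.mem_coe.2 (Finset.mem_image_of_mem _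
          (Finset.mem_univ i)))
      | zero => exact Subgroup.one_mem _
      | add a b _ _ ha hb => exact Subgroup.mul_mem _ ha hb
      | smul r a _ ha =>
        rcases (by decide : ∀ r : ZMod 2, r = 0 ∨ r = 1) r with rfl | rfl
        · rw [zero_smul]; exact Subgroup.one_mem _
        · rwa [one_smul]
    have hb : Subgroup.closure (t : Set G) = ⊤ := by
      rw [eq_top_iff]
      exact fun x _ => key (Additive.ofMul x) (by rw [b.span_eq]; trivial)
    refine (Group.rank_le hb).trans (Finset.card_image_le.trans ?_)
    simp

lemma star_dotProduct_self {n : ℕ} (ψ : (Fin n → Fin 2) → ℂ) :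
    star ψ ⬝ᵥ ψ = ((∑ x, Complex.normSq (ψ x) : ℝ) : ℂ) := by
  simp [dotProduct, Complex.normSq_eq_conj_mul_self]

lemma sum_normSq_pos {n : ℕ} {ψ : (Fin n → Fin 2) → ℂ} (hψ : ψ ≠ 0) :
    0 < ∑ x, Complex.normSq (ψ x) := by
  obtain ⟨x, hx⟩ := Function.ne_iff.1 hψ
  exact Finset.sum_pos' (fun _ _ => Complex.normSq_nonneg _)
    ⟨x, Finset.mem_univ x, Complex.normSq_pos.2 hx⟩

lemma exists_smul_unit {n : ℕ} {ψ : (Fin n → Fin 2) → ℂ} (hψ : ψ ≠ 0) :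
    ∃ c : ℂ, star (c • ψ) ⬝ᵥ (c • ψ) = 1 := by
  have h := sum_normSq_pos hψ
  refine ⟨((Real.sqrt (∑ x, Complex.normSq (ψ x)))⁻¹ : ℝ), ?_⟩
  rw [star_smul, smul_dotProduct, dotProduct_smul, star_dotProduct_self]
  simp only [smul_eq_mul, Complex.star_def, Complex.conj_ofReal]
  norm_cast
  have h2 := Real.sq_sqrt h.le
  have h3 : Real.sqrt (∑ x, Complex.normSq (ψ x)) ≠ 0 := (Real.sqrt_pos.2 h).ne'
  field_simp
  exact h2.symm

lemma IsStabilizerGroup.trace_eq_zero {n : ℕ} {S : Subgroup (QubitOp n)ˣ}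
    (hS : IsStabilizerGroup S) {g : (QubitOp n)ˣ} (hg : g ∈ S) (h1 : g ≠ 1) :
    (g : QubitOp n).trace = 0 := by
  obtain ⟨v, h⟩ := hS.exists_pauliOf hg
  by_cases hv : v = 0
  · subst hv
    rw [pauliOf_zero] at h
    rcases h with h | h
    · exact absurd (Units.ext h) h1
    · exact absurd ((Units.ext h : g = -1) ▸ hg) hS.neg_one_notMem
  · rcases h with h | h <;> simp [h, trace_pauliOf hv]

lemma IsStabilizerGroup.exists_fixed {n : ℕ} {S : Subgroup (QubitOp n)ˣ}
    (hS : IsStabilizerGroup S) :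
    ∃ ψ : (Fin n → Fin 2) → ℂ, star ψ ⬝ᵥ ψ = 1 ∧ ∀ s ∈ S, (s : QubitOp n).mulVec ψ = ψ := by
  classical
  have := hS.finite
  have := Fintype.ofFinite S
  set A : QubitOp n := ∑ g : S, ((g : (QubitOp n)ˣ) : QubitOp n) with hA
  have htr : A.trace = 2 ^ n := by
    rw [hA, Matrix.trace_sum, Finset.sum_eq_single (1 : S)]
    · simp
    · intro g _ hg
      exact hS.trace_eq_zero g.2 fun h => hg (Subtype.ext h)
    · simp
  have hA0 : A ≠ 0 := by
    intro h
    rw [h, Matrix.trace_zero] at htr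
    exact pow_ne_zero n two_ne_zero htr.symm
  obtain ⟨φ, hφ⟩ : ∃ φ, A.mulVec φ ≠ 0 := by
    by_contra! h
    exact hA0 (Matrix.ext_of_mulVec_single fun i => by rw [h, Matrix.zero_mulVec])
  obtain ⟨c, hc⟩ := exists_smul_unit hφ
  refine ⟨_, hc, fun s hs => ?_⟩
  rw [Matrix.mulVec_smul, Matrix.mulVec_mulVec]
  congr 2
  rw [hA, Finset.mul_sum]
  refine Fintype.sum_equiv (Equiv.mulLeft (⟨s, hs⟩ : S)) _ _ fun g => ?_
  simp

lemma finite_stabilizerGroups (n : ℕ) :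
    {S : Subgroup (QubitOp n)ˣ | IsStabilizerGroup S}.Finite :=
  Set.Finite.of_injOn (f := fun S : Subgroup (QubitOp n)ˣ => (S : Set (QubitOp n)ˣ))
    (t := {s | s ⊆ (pauliGroup n : Set (QubitOp n)ˣ)})
    (fun _ hS => IsStabilizerGroup.le_pauliGroup hS)
    SetLike.coe_injective.injOn (finite_pauliGroup n).finite_subsets

/-- A Pauli string as an invertible operator. -/
def pauliUnit {n : ℕ} (v : Fin n → ZMod 2 × ZMod 2) : (QubitOp n)ˣ :=
  ⟨pauliOf v, pauliOf v, pauliOf_sq v, pauliOf_sq v⟩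

lemma pauliUnit_mul_self {n : ℕ} (v : Fin n → ZMod 2 × ZMod 2) :
    pauliUnit v * pauliUnit v = 1 :=
  Units.ext (pauliOf_sq v)

lemma pauliUnit_mem_pauliGroup {n : ℕ} (v : Fin n → ZMod 2 × ZMod 2) :
    pauliUnit v ∈ pauliGroup n :=
  Subgroup.subset_closure ⟨1, fun i => labelOfBits (v i), by simp, by simp [pauliUnit, pauliOf]⟩

/-- The subgroup generated by `S` and a commuting involution `u`. -/
def adjoinInvolution {G : Type*} [Group G] (S : Subgroup G) (u : G) (hu : u * u = 1)
    (h : ∀ g ∈ S, u * g = g * u) : Subgroup G where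
  carrier := {x | x ∈ S ∨ x * u ∈ S}
  one_mem' := Or.inl S.one_mem
  mul_mem' := by
    have hc : ∀ x, x * u ∈ S → u * x = x * u := fun x hx => by
      have := h _ hx
      rw [← mul_assoc] at this
      exact mul_right_cancel this
    rintro a b (ha | ha) (hb | hb)
    · exact Or.inl (S.mul_mem ha hb)
    · exact Or.inr (by simpa [mul_assoc] using S.mul_mem ha hb)
    · exact Or.inr (by rw [mul_assoc, ← h b hb, ← mul_assoc]; exact S.mul_mem ha hb)
    · refine Or.inl ?_
      have : a * u * (b * u) = a * b := by
        rw [← hc b hb, mul_assoc, ← mul_assoc u u b, hu, one_mul]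
      exact this ▸ S.mul_mem ha hb
  inv_mem' := by
    rintro a (ha | ha)
    · exact Or.inl (S.inv_mem ha)
    · refine Or.inr ?_
      have hui : u⁻¹ = u := inv_eq_of_mul_eq_one_left hu
      have h1 := S.inv_mem ha
      have h2 := h _ h1
      rw [mul_inv_rev, hui] at h1 h2
      rw [← mul_assoc, hu, one_mul] at h2
      have : a⁻¹ * u = u * a⁻¹ := by
        conv_lhs => rw [h2]
        rw [mul_assoc, hu, mul_one]
      exact this ▸ h1

lemma IsStabilizerGroup.adjoin {n : ℕ} {S : Subgroup (QubitOp n)ˣ} (hS : IsStabilizerGroup S)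
    {v : Fin n → ZMod 2 × ZMod 2} (hv : v ∉ exponents S)
    (h : ∀ g ∈ S, pauliUnit v * g = g * pauliUnit v) :
    IsStabilizerGroup (adjoinInvolution S (pauliUnit v) (pauliUnit_mul_self v) h) := by
  set u := pauliUnit v
  have huu : u * u = 1 := pauliUnit_mul_self v
  have hform : ∀ x ∈ adjoinInvolution S u huu h, ∃ g ∈ S, x = g ∨ x = g * u := by
    rintro x (hx | hx)
    · exact ⟨x, hx, Or.inl rfl⟩
    · exact ⟨x * u, hx, Or.inr (by rw [mul_assoc, huu, mul_one])⟩
  refine ⟨fun x hx => ?_, fun a ha b hb => ?_, fun hx => ?_⟩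
  · obtain ⟨g, hg, rfl | rfl⟩ := hform x hx
    · exact hS.le_pauliGroup hg
    · exact mul_mem (hS.le_pauliGroup hg) (pauliUnit_mem_pauliGroup v)
  · have key : ∀ x ∈ adjoinInvolution S u huu h, ∀ g ∈ S, Commute x g := by
      intro x hx g hg
      obtain ⟨k, hk, rfl | rfl⟩ := hform x hx
      · exact hS.comm _ hk _ hg
      · exact Commute.mul_left (hS.comm _ hk _ hg) (h g hg)
    have key2 : ∀ x ∈ adjoinInvolution S u huu h, Commute x u := by
      intro x hx
      obtain ⟨k, hk, rfl | rfl⟩ := hform x hx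
      · exact (h _ hk).symm
      · exact Commute.mul_left (h k hk).symm (Commute.refl u)
    obtain ⟨k, hk, rfl | rfl⟩ := hform b hb
    · exact key a ha _ hk
    · exact Commute.mul_right (key a ha _ hk) (key2 a ha)
  · rcases hx with hx | hx
    · exact hS.neg_one_notMem hx
    · exact hv ⟨_, hx, Or.inr (by simp [pauliUnit])⟩

lemma pauliOf_commute_or_anticommute {n : ℕ} (u v : Fin n → ZMod 2 × ZMod 2) :
    pauliOf u * pauliOf v = pauliOf v * pauliOf u ∨
      pauliOf u * pauliOf v = -(pauliOf v * pauliOf u) := by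
  rw [pauliOf_mul_comm u v, zmodSign]
  split_ifs <;> simp

lemma IsStabilizerGroup.exists_anticommute {n : ℕ} {S : Subgroup (QubitOp n)ˣ}
    (hS : IsStabilizerGroup S) (hmax : ∀ T, IsStabilizerGroup T → S ≤ T → T ≤ S)
    {v : Fin n → ZMod 2 × ZMod 2} (hv : v ∉ exponents S) :
    ∃ g ∈ S, pauliOf v * (g : QubitOp n) = -((g : QubitOp n) * pauliOf v) := by
  by_contra! hne
  have h : ∀ g ∈ S, pauliUnit v * g = g * pauliUnit v := by
    intro g hg
    obtain ⟨w, hw⟩ := hS.exists_pauliOf hg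
    apply Units.ext
    have h1 := hne g hg
    have h2 := pauliOf_commute_or_anticommute v w
    simp only [pauliUnit, Units.val_mul]
    rcases hw with hw | hw <;> rw [hw] at h1 ⊢ <;> rcases h2 with h2 | h2 <;> simp_all
  refine hv ⟨pauliUnit v, hmax _ (hS.adjoin hv h) (fun x hx => Or.inl hx) (Or.inr ?_), Or.inl rfl⟩
  rw [pauliUnit_mul_self]
  exact S.one_mem

/-- Every stabilizer group fixes a pure stabilizer state. -/
lemma IsStabilizerGroup.exists_pure {n : ℕ} {S : Subgroup (QubitOp n)ˣ}
    (hS : IsStabilizerGroup S) :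
    ∃ ψ : (Fin n → Fin 2) → ℂ, star ψ ⬝ᵥ ψ = 1 ∧ (∀ s ∈ S, (s : QubitOp n).mulVec ψ = ψ) ∧
      IsPureStabilizerState (Matrix.vecMulVec ψ (star ψ)) := by
  obtain ⟨T, hST, hT⟩ := (finite_stabilizerGroups n).exists_le_maximal hS
  have hTs : IsStabilizerGroup T := hT.1
  obtain ⟨ψ, hψ, hfix⟩ := hTs.exists_fixed
  refine ⟨ψ, hψ, fun s hs => hfix s (hST hs), T, hTs, ?_, ψ, hψ, hfix, rfl⟩
  have := hTs.finite
  have hcard : Nat.card T = 2 ^ n := by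
    refine card_eq_of_expVal_re_eq_zero hTs hψ hfix fun v hv => ?_
    obtain ⟨g, hg, h⟩ := hTs.exists_anticommute (fun T' h1 h2 => hT.2 h1 h2) hv
    rw [expVal_eq_zero_of_anticomm (c := 1) (hTs.conjTranspose hg) one_ne_zero (by simp)
      (by simp [hfix g hg]) h, Complex.zero_re]
  refine ⟨inferInstance, ?_⟩
  rw [card_eq_two_pow_rank fun g : T => Subtype.ext (hTs.mul_self g.2)] at hcard
  exact Nat.pow_right_injective le_rfl hcard

lemma IsPureStabilizerState.exists_expVal {n : ℕ} {ρ : QubitOp n}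
    (hρ : IsPureStabilizerState ρ) :
    ∃ (S : Subgroup (QubitOp n)ˣ) (ψ : (Fin n → Fin 2) → ℂ), IsStabilizerGroup S ∧
      star ψ ⬝ᵥ ψ = 1 ∧ ρ = Matrix.vecMulVec ψ (star ψ) ∧
      ∀ v, v ∉ exponents S → (expVal ψ (pauliOf v)).re = 0 := by
  obtain ⟨S, hS, ⟨hfg, hrank⟩, ψ, hψ, hfix, rfl⟩ := hρ
  refine ⟨S, ψ, hS, hψ, rfl, fun v hv => expVal_re_eq_zero_of_card hS hψ hfix ?_ hv⟩
  have := hS.finite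
  rw [card_eq_two_pow_rank fun g : S => Subtype.ext (hS.mul_self g.2)]
  exact congrArg (2 ^ ·) hrank

lemma IsPauliObservable.exists_pauliOf {n : ℕ} {P : QubitOp n} (hP : IsPauliObservable P) :
    ∃ v, P = pauliOf v ∨ P = -pauliOf v := by
  obtain ⟨s, h⟩ := hP
  obtain ⟨v, hv⟩ := _root_.exists_pauliOf s
  exact ⟨v, hv ▸ h⟩

lemma IsPauliObservable.mul_self {n : ℕ} {P : QubitOp n} (hP : IsPauliObservable P) :
    P * P = 1 := by
  obtain ⟨v, rfl | rfl⟩ := hP.exists_pauliOf <;> simp [pauliOf_sq]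

lemma IsPauliObservable.conjTranspose {n : ℕ} {P : QubitOp n} (hP : IsPauliObservable P) :
    P.conjTranspose = P := by
  obtain ⟨v, rfl | rfl⟩ := hP.exists_pauliOf <;> simp [pauliOf_conjTranspose]

lemma IsPauliObservable.commute_or_anticommute {n : ℕ} {P Q : QubitOp n}
    (hP : IsPauliObservable P) (hQ : IsPauliObservable Q) :
    P * Q = Q * P ∨ P * Q = -(Q * P) := by
  obtain ⟨u, hu⟩ := hP.exists_pauliOf
  obtain ⟨v, hv⟩ := hQ.exists_pauliOf
  have h := pauliOf_commute_or_anticommute u v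
  rcases hu with rfl | rfl <;> rcases hv with rfl | rfl <;> simpa [neg_eq_iff_eq_neg] using h

lemma IsPauliObservable.ne_zero {n : ℕ} {P : QubitOp n} (hP : IsPauliObservable P) : P ≠ 0 := by
  rintro rfl
  exact one_ne_zero (hP.mul_self.symm.trans (mul_zero _))

/-- Commuting Pauli observables do not anticommute. -/
lemma IsPauliObservable.not_anticommute {n : ℕ} {P Q : QubitOp n}
    (hP : IsPauliObservable P) (hQ : IsPauliObservable Q) (h : P * Q = Q * P) :
    P * Q ≠ -(Q * P) := by
  intro h2
  have h3 : P * Q = 0 := by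
    have h4 : P * Q = -(P * Q) := h2.trans (by rw [h])
    ext x y
    exact self_eq_neg.1 (congrFun (congrFun h4 x) y)
  have h4 : P * (P * Q) = Q := by rw [← mul_assoc, hP.mul_self, one_mul]
  rw [h3, mul_zero] at h4
  exact hQ.ne_zero h4.symm

section signs

variable {n : ℕ} {M : Finset (QubitOp n)}

lemma signVector_of_mem {S : Set M} {f : S → ℤˣ} {P : M} (h : P ∈ S) :
    signVector S f P = ((f ⟨P, h⟩ : ℤ) : ℝ) := by
  simp [signVector, h]

lemma signVector_of_notMem {S : Set M} {f : S → ℤˣ} {P : M} (h : P ∉ S) :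
    signVector S f P = 0 := by
  simp [signVector, h]

lemma commute_of_isIndepSet (hM : ∀ P ∈ M, IsPauliObservable P) {S : Set M}
    (hS : (frustrationGraph M).IsIndepSet S) {P Q : M} (hP : P ∈ S) (hQ : Q ∈ S) :
    (P : QubitOp n) * (Q : QubitOp n) = (Q : QubitOp n) * (P : QubitOp n) := by
  by_cases h : P = Q
  · rw [h]
  · exact ((hM P P.2).commute_or_anticommute (hM Q Q.2)).resolve_right
      fun h2 => hS hP hQ h ⟨h, h2⟩

/-- A maximal independent set contains an anticommuting partner of every operator outside it. -/
lemma exists_anticommute_of_notMem {S : Set M} (hS : S ∈ maxIndepSets M) {P : M} (hP : P ∉ S) :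
    ∃ Q ∈ S, (frustrationGraph M).Adj P Q := by
  by_contra! h
  refine hP (hS.2 (y := insert P S) ?_ (Set.subset_insert P S) (Set.mem_insert P S))
  refine Set.Pairwise.insert hS.1 fun Q hQ _ => ⟨h Q hQ, fun h2 => h Q hQ h2.symm⟩

lemma unit_int_cast_mul_self (z : ℤˣ) : ((z : ℤ) : ℂ) * ((z : ℤ) : ℂ) = 1 := by
  rcases Int.units_eq_one_or z with rfl | rfl <;> simp

/-- The signed operator `f_P P`. -/
def signedUnit (hM : ∀ P ∈ M, IsPauliObservable P) {S : Set M} (f : S → ℤˣ) (P : S) :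
    (QubitOp n)ˣ :=
  have h : (((f P : ℤ) : ℂ) • ((P : M) : QubitOp n)) * (((f P : ℤ) : ℂ) • ((P : M) : QubitOp n))
      = 1 := by
    rw [smul_mul_smul_comm, unit_int_cast_mul_self, (hM _ P.1.2).mul_self, one_smul]
  ⟨_, _, h, h⟩

lemma coe_signedUnit (hM : ∀ P ∈ M, IsPauliObservable P) {S : Set M} (f : S → ℤˣ) (P : S) :
    (signedUnit hM f P : QubitOp n) = ((f P : ℤ) : ℂ) • ((P : M) : QubitOp n) :=
  rfl

lemma List.exists_nodup_prod_eq {ι G : Type*} [Group G] {g : ι → G}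
    (hsq : ∀ i, g i * g i = 1) (hcomm : ∀ i j, Commute (g i) (g j)) (l : List ι) :
    ∃ l' : List ι, l'.Nodup ∧ (l'.map g).prod = (l.map g).prod := by
  classical
  induction l with
  | nil => exact ⟨[], by simp⟩
  | cons a l ih =>
    obtain ⟨l', hl', h⟩ := ih
    by_cases ha : a ∈ l'
    · refine ⟨l'.erase a, hl'.erase a, ?_⟩
      have hp : (l'.map g).prod = ((a :: l'.erase a).map g).prod := by
        refine List.Perm.prod_eq' ((List.perm_cons_erase ha).map g) ?_
        rw [List.pairwise_map]
        exact List.pairwise_of_forall fun i j => hcomm i j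
      rw [List.map_cons, List.prod_cons, ← h, hp, List.map_cons, List.prod_cons, ← mul_assoc, hsq,
        one_mul]
    · exact ⟨a :: l', List.nodup_cons.2 ⟨ha, hl'⟩, by simp [h]⟩

lemma signedUnit_commute (hM : ∀ P ∈ M, IsPauliObservable P) {S : Set M}
    (hS : (frustrationGraph M).IsIndepSet S) (f : S → ℤˣ) (P Q : S) :
    Commute (signedUnit hM f P) (signedUnit hM f Q) := by
  apply Units.ext
  simp only [signedUnit, Units.val_mul]
  rw [smul_mul_smul_comm, smul_mul_smul_comm, mul_comm, commute_of_isIndepSet hM hS P.2 Q.2]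

lemma signedUnit_mul_self (hM : ∀ P ∈ M, IsPauliObservable P) {S : Set M}
    (f : S → ℤˣ) (P : S) : signedUnit hM f P * signedUnit hM f P = 1 := by
  rw [← mul_inv_cancel (signedUnit hM f P)]
  rfl

lemma isStabilizerGroup_closure_signedUnit (hM : ∀ P ∈ M, IsPauliObservable P) {S : Set M}
    (hS : (frustrationGraph M).IsIndepSet S) {f : S → ℤˣ} (hf : f ∈ admissibleSigns S) :
    IsStabilizerGroup (Subgroup.closure (Set.range (signedUnit hM f))) := by
  refine ⟨?_, ?_, ?_⟩
  · refine (Subgroup.closure_le _).2 ?_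
    rintro _ ⟨P, rfl⟩
    obtain ⟨s, hs⟩ := hM _ P.1.2
    have hz : (((f P : ℤ) : ℂ)) ^ 4 = 1 := by
      rcases Int.units_eq_one_or (f P) with h | h <;> rw [h] <;> norm_num
    rcases hs with hs | hs
    · exact Subgroup.subset_closure ⟨((f P : ℤ) : ℂ), s, hz, by rw [coe_signedUnit, hs]⟩
    · exact Subgroup.subset_closure ⟨-((f P : ℤ) : ℂ), s, by rw [Even.neg_pow (by decide), hz],
        by rw [coe_signedUnit, hs, smul_neg, neg_smul]⟩
  · intro a ha b hb
    have := Subgroup.isMulCommutative_closure (k := Set.range (signedUnit hM f)) (by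
      rintro _ ⟨P, rfl⟩ _ ⟨Q, rfl⟩
      exact signedUnit_commute hM hS f P Q)
    exact congrArg Subtype.val (mul_comm'
      (⟨a, ha⟩ : Subgroup.closure (Set.range (signedUnit hM f))) ⟨b, hb⟩)
  · intro hmem
    rw [← Subgroup.mem_toSubmonoid, Subgroup.closure_toSubmonoid] at hmem
    obtain ⟨l, hl, hprod⟩ := Submonoid.exists_list_of_mem_closure hmem
    have hl' : ∃ k : List S, k.map (signedUnit hM f) = l := by
      have : l ∈ Set.range (List.map (signedUnit hM f)) := by
        rw [Set.range_list_map]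
        intro y hy
        rcases hl y hy with h | ⟨P, h⟩
        · exact h
        · refine ⟨P, ?_⟩
          rw [← inv_inv y, ← h]
          exact (inv_eq_of_mul_eq_one_left (signedUnit_mul_self hM f P)).symm
      exact this
    obtain ⟨k, rfl⟩ := hl'
    obtain ⟨k', hk', h⟩ := List.exists_nodup_prod_eq (signedUnit_mul_self hM f)
      (signedUnit_commute hM hS f) k
    apply hf k' hk'
    have h2 := congrArg (Units.coeHom (QubitOp n)) (h.trans hprod)
    rw [map_list_prod, List.map_map] at h2
    exact h2

/-- Admissible signs are realized by a pure stabilizer state. -/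
lemma exists_state_of_admissible (hM : ∀ P ∈ M, IsPauliObservable P) {S : Set M}
    (hS : (frustrationGraph M).IsIndepSet S) {f : S → ℤˣ} (hf : f ∈ admissibleSigns S) :
    ∃ ψ : (Fin n → Fin 2) → ℂ, star ψ ⬝ᵥ ψ = 1 ∧
      (∀ P : S, ((P : M) : QubitOp n).mulVec ψ = ((f P : ℤ) : ℂ) • ψ) ∧
      IsPureStabilizerState (Matrix.vecMulVec ψ (star ψ)) := by
  obtain ⟨ψ, hψ, hfix, hpure⟩ := (isStabilizerGroup_closure_signedUnit hM hS hf).exists_pure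
  refine ⟨ψ, hψ, fun P => ?_, hpure⟩
  have h := hfix _ (Subgroup.subset_closure ⟨P, rfl⟩)
  have h2 : ((f P : ℤ) : ℂ) • ((P : M) : QubitOp n).mulVec ψ = ψ := by
    rw [← Matrix.smul_mulVec]
    exact h
  conv_rhs => rw [← h2]
  rw [smul_smul, unit_int_cast_mul_self, one_smul]

/-- Signs for which a joint eigenvector exists are admissible. -/
lemma mem_admissibleSigns_of_eigenvector {S : Set M} {f : S → ℤˣ}
    {ψ : (Fin n → Fin 2) → ℂ} (hψ : ψ ≠ 0)
    (h : ∀ P : S, ((P : M) : QubitOp n).mulVec ψ = ((f P : ℤ) : ℂ) • ψ) :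
    f ∈ admissibleSigns S := by
  intro l _ hl
  have key : ∀ l : List S,
      ((l.map fun P => ((f P : ℤ) : ℂ) • ((P : M) : QubitOp n)).prod).mulVec ψ = ψ := by
    intro l
    induction l with
    | nil => simp
    | cons P l ih =>
      rw [List.map_cons, List.prod_cons, ← Matrix.mulVec_mulVec, ih, Matrix.smul_mulVec, h P,
        smul_smul, unit_int_cast_mul_self, one_smul]
  have h2 := key l
  rw [hl, Matrix.neg_mulVec, Matrix.one_mulVec] at h2
  exact hψ (self_eq_neg.1 h2.symm)

end signs

section polytope

variable {n : ℕ} {M : Finset (QubitOp n)}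

lemma isLinearMap_expectationVector (M : Finset (QubitOp n)) :
    IsLinearMap ℝ (expectationVector M) where
  map_add ρ σ := by ext P; simp [expectationVector, mul_add]
  map_smul c ρ := by ext P; simp [expectationVector]

lemma reducedPolytope_eq_convexHull (M : Finset (QubitOp n)) :
    reducedPolytope M = convexHull ℝ (expectationVector M '' {ρ | IsPureStabilizerState ρ}) :=
  (isLinearMap_expectationVector M).image_convexHull _

lemma expectationVector_vecMulVec (ψ : (Fin n → Fin 2) → ℂ) (P : M) :
    expectationVector M (Matrix.vecMulVec ψ (star ψ)) P = (expVal ψ (P : QubitOp n)).re := by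
  rw [expectationVector, trace_mul_vecMulVec]

lemma stabVectors_subset_reducedPolytope (hM : ∀ P ∈ M, IsPauliObservable P) :
    stabVectors M ⊆ reducedPolytope M := by
  rintro _ ⟨S, hS, f, hf, rfl⟩
  obtain ⟨ψ, hψ, heig, hpure⟩ := exists_state_of_admissible hM hS.1 hf
  refine ⟨_, subset_convexHull ℝ _ hpure, funext fun P => ?_⟩
  rw [expectationVector_vecMulVec]
  by_cases hP : P ∈ S
  · rw [signVector_of_mem hP, expVal_of_mulVec (heig ⟨P, hP⟩), hψ]
    simp
  · obtain ⟨Q, hQ, -, h⟩ := exists_anticommute_of_notMem hS hP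
    rw [signVector_of_notMem hP, expVal_eq_zero_of_anticomm (hM Q Q.2).conjTranspose
      (by simp) (by simp) (heig ⟨Q, hQ⟩) h, Complex.zero_re]

open Classical in
/-- The normalized expectation values in the state `φ` of the operators in `S`. -/
def restrictedExpectation (S : Set M) (φ : (Fin n → Fin 2) → ℂ) : M → ℝ :=
  fun P => if P ∈ S then (expVal φ (P : QubitOp n)).re / (expVal φ 1).re else 0

lemma expVal_one (φ : (Fin n → Fin 2) → ℂ) : expVal φ 1 = star φ ⬝ᵥ φ := by
  rw [expVal, Matrix.one_mulVec]

lemma expVal_one_re_pos {φ : (Fin n → Fin 2) → ℂ} (hφ : φ ≠ 0) : 0 < (expVal φ 1).re := by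
  rw [expVal_one, star_dotProduct_self, Complex.ofReal_re]
  exact sum_normSq_pos hφ

/-- The parallelogram identity for the components of `φ` in the eigenspaces of `B`. -/
lemma expVal_add_expVal_sub {A B : QubitOp n} (hB : B.conjTranspose = B) (hBB : B * B = 1)
    (hAB : A * B = B * A) (φ : (Fin n → Fin 2) → ℂ) :
    expVal (φ + B.mulVec φ) A + expVal (φ - B.mulVec φ) A = 4 * expVal φ A := by
  have h : star (B.mulVec φ) ⬝ᵥ A.mulVec (B.mulVec φ) = expVal φ A := by
    rw [star_dotProduct_mulVec_comm hB, Matrix.mulVec_mulVec, Matrix.mulVec_mulVec, mul_assoc,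
      hAB, ← mul_assoc, hBB, one_mul, expVal]
  simp only [expVal, Matrix.mulVec_add, Matrix.mulVec_sub, star_add, star_sub, add_dotProduct,
    sub_dotProduct, dotProduct_add, dotProduct_sub] at h ⊢
  linear_combination 2 * h

lemma restrictedExpectation_mem_convexHull (hM : ∀ P ∈ M, IsPauliObservable P) {S : Set M}
    (hS : S ∈ maxIndepSets M) (T : Finset M) :
    ∀ φ : (Fin n → Fin 2) → ℂ, φ ≠ 0 →
      (∀ P ∈ S, P ∉ T → ∃ z : ℤˣ, (P : QubitOp n).mulVec φ = ((z : ℤ) : ℂ) • φ) →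
      restrictedExpectation S φ ∈ convexHull ℝ (stabVectors M) := by
  classical
  induction T using Finset.induction_on with
  | empty =>
    intro φ hφ h
    choose f hf using fun P : S => h P P.2 (Finset.notMem_empty _)
    refine subset_convexHull ℝ _ ⟨S, hS, f, mem_admissibleSigns_of_eigenvector hφ hf, ?_⟩
    ext P
    by_cases hP : P ∈ S
    · have hr := (expVal_one_re_pos hφ).ne'
      rw [signVector_of_mem hP, restrictedExpectation, if_pos hP, expVal_of_mulVec (hf ⟨P, hP⟩),
        ← expVal_one]
      simp [hr]
    · rw [signVector_of_notMem hP, restrictedExpectation, if_neg hP]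
  | insert j T hj ih =>
    intro φ hφ h
    by_cases hjS : j ∈ S
    swap
    · exact ih φ hφ fun P hP hPT => h P hP fun h2 => by
        rcases Finset.mem_insert.1 h2 with rfl | h2
        · exact hjS hP
        · exact hPT h2
    have hjj := (hM j j.2).mul_self
    have hjh := (hM j j.2).conjTranspose
    have hcomm : ∀ P ∈ S, (P : QubitOp n) * (j : QubitOp n) = (j : QubitOp n) * (P : QubitOp n) :=
      fun P hP => commute_of_isIndepSet hM hS.1 hP hjS
    set χ := (j : QubitOp n).mulVec φ with hχ
    have hjχ : (j : QubitOp n).mulVec χ = φ := by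
      rw [hχ, Matrix.mulVec_mulVec, hjj, Matrix.one_mulVec]
    have heig : ∀ P ∈ S, P ∉ T → P ≠ j → ∃ z : ℤˣ,
        (P : QubitOp n).mulVec φ = ((z : ℤ) : ℂ) • φ ∧
        (P : QubitOp n).mulVec χ = ((z : ℤ) : ℂ) • χ := by
      intro P hP hPT hPj
      obtain ⟨z, hz⟩ := h P hP (by simp [hPT, hPj])
      refine ⟨z, hz, ?_⟩
      rw [hχ, Matrix.mulVec_mulVec, hcomm P hP, ← Matrix.mulVec_mulVec, hz, Matrix.mulVec_smul]
    by_cases h1 : φ + χ = 0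
    · refine ih φ hφ fun P hP hPT => ?_
      by_cases hPj : P = j
      · refine ⟨-1, ?_⟩
        rw [hPj, ← hχ, eq_neg_of_add_eq_zero_right h1]
        simp
      · exact (heig P hP hPT hPj).imp fun z hz => hz.1
    by_cases h2 : φ - χ = 0
    · refine ih φ hφ fun P hP hPT => ?_
      by_cases hPj : P = j
      · refine ⟨1, ?_⟩
        rw [hPj, ← hχ, ← sub_eq_zero.1 h2]
        simp
      · exact (heig P hP hPT hPj).imp fun z hz => hz.1
    have m1 := ih (φ + χ) h1 fun P hP hPT => by
      by_cases hPj : P = j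
      · refine ⟨1, ?_⟩
        rw [hPj, Matrix.mulVec_add, hjχ, ← hχ, add_comm]
        simp
      · obtain ⟨z, hz, hz'⟩ := heig P hP hPT hPj
        exact ⟨z, by rw [Matrix.mulVec_add, hz, hz', smul_add]⟩
    have m2 := ih (φ - χ) h2 fun P hP hPT => by
      by_cases hPj : P = j
      · refine ⟨-1, ?_⟩
        rw [hPj, Matrix.mulVec_sub, hjχ, ← hχ]
        simp
      · obtain ⟨z, hz, hz'⟩ := heig P hP hPT hPj
        exact ⟨z, by rw [Matrix.mulVec_sub, hz, hz', smul_sub]⟩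
    have r0 := expVal_one_re_pos hφ
    have r1 := expVal_one_re_pos h1
    have r2 := expVal_one_re_pos h2
    have hsum : ∀ A : QubitOp n, A * (j : QubitOp n) = (j : QubitOp n) * A →
        (expVal (φ + χ) A).re + (expVal (φ - χ) A).re = 4 * (expVal φ A).re := by
      intro A hA
      have := congrArg Complex.re (expVal_add_expVal_sub hjh hjj hA φ)
      simpa using this
    have hr := hsum 1 (by simp)
    have hconv := convex_convexHull ℝ (stabVectors M) m1 m2
      (a := (expVal (φ + χ) 1).re / (4 * (expVal φ 1).re))
      (b := (expVal (φ - χ) 1).re / (4 * (expVal φ 1).re)) (by positivity) (by positivity)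
      (by rw [← add_div, hr, div_self (by positivity)])
    convert hconv using 1
    ext P
    by_cases hP : P ∈ S
    · have hPs := hsum P (hcomm P hP)
      simp only [restrictedExpectation, if_pos hP, Pi.add_apply, Pi.smul_apply, smul_eq_mul]
      field_simp
      linarith
    · simp [restrictedExpectation, hP]

lemma reducedPolytope_eq (hM : ∀ P ∈ M, IsPauliObservable P) :
    reducedPolytope M = convexHull ℝ (stabVectors M) := by
  apply Set.Subset.antisymm
  · rw [reducedPolytope_eq_convexHull]
    refine convexHull_min ?_ (convex_convexHull ℝ _)
    rintro _ ⟨ρ, hρ, rfl⟩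
    obtain ⟨G, ψ, hG, hψ, rfl, h0⟩ := IsPureStabilizerState.exists_expVal hρ
    have hmem : ∀ P : M, (expVal ψ (P : QubitOp n)).re ≠ 0 →
        ∃ g ∈ G, (P : QubitOp n) = g ∨ (P : QubitOp n) = -g := by
      intro P hP
      obtain ⟨v, hv⟩ := (hM P P.2).exists_pauliOf
      have hvG : v ∈ exponents G := by
        by_contra hvG
        apply hP
        rcases hv with hv | hv
        · rw [hv, h0 v hvG]
        · have := h0 v hvG
          rw [hv]
          simpa [expVal, Matrix.neg_mulVec] using this
      obtain ⟨g, hg, h⟩ := hvG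
      refine ⟨g, hg, ?_⟩
      rcases hv with hv | hv <;> rcases h with h | h <;> simp [hv, h]
    have hind : (frustrationGraph M).IsIndepSet {P : M | (expVal ψ (P : QubitOp n)).re ≠ 0} := by
      intro P hP Q hQ _ hadj
      refine (hM P P.2).not_anticommute (hM Q Q.2) ?_ hadj.2
      obtain ⟨g, hg, hPg⟩ := hmem P hP
      obtain ⟨k, hk, hQk⟩ := hmem Q hQ
      have hgk := congrArg (fun u : (QubitOp n)ˣ => (u : QubitOp n)) (hG.comm g hg k hk)
      simp only [Units.val_mul] at hgk
      rcases hPg with hPg | hPg <;> rcases hQk with hQk | hQk <;> simp [hPg, hQk, hgk]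
    obtain ⟨S, hle, hS⟩ := (Set.toFinite
      {S : Set M | (frustrationGraph M).IsIndepSet S}).exists_le_maximal hind
    have hψ0 : ψ ≠ 0 := by rintro rfl; simp at hψ
    convert restrictedExpectation_mem_convexHull hM hS Finset.univ ψ hψ0 (by simp) using 1
    ext P
    rw [expectationVector_vecMulVec]
    by_cases hP : P ∈ S
    · rw [restrictedExpectation, if_pos hP]
      simp [expVal, hψ]
    · rw [restrictedExpectation, if_neg hP]
      by_contra h
      exact hP (hle h)
  · refine convexHull_min (stabVectors_subset_reducedPolytope hM) ?_
    rw [reducedPolytope_eq_convexHull]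
    exact convex_convexHull ℝ _

lemma abs_signVector_le (S : Set M) (f : S → ℤˣ) (P : M) : |signVector S f P| ≤ 1 := by
  by_cases hP : P ∈ S
  · rw [signVector_of_mem hP]
    rcases Int.units_eq_one_or (f ⟨P, hP⟩) with h | h <;> simp [h]
  · simp [signVector_of_notMem hP]

lemma convexOn_abs_apply (P : M) : ConvexOn ℝ Set.univ fun x : M → ℝ => |x P| :=
  (convexOn_norm (E := ℝ) convex_univ).comp_linearMap
    (LinearMap.proj P : (M → ℝ) →ₗ[ℝ] ℝ)

lemma abs_le_one_of_mem_convexHull {x : M → ℝ} (hx : x ∈ convexHull ℝ (stabVectors M)) (P : M) :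
    |x P| ≤ 1 := by
  have hconv : ConvexOn ℝ Set.univ fun x : M → ℝ => |x P| :=
    convexOn_abs_apply P
  refine convexHull_min (t := {x | x ∈ Set.univ ∧ |x P| ≤ 1}) ?_ (hconv.convex_le 1) hx |>.2
  rintro _ ⟨S, -, f, -, rfl⟩
  exact ⟨trivial, abs_signVector_le S f P⟩

lemma abs_add_abs_le_one_of_mem_convexHull {x : M → ℝ}
    (hx : x ∈ convexHull ℝ (stabVectors M)) {P Q : M} (hPQ : (frustrationGraph M).Adj P Q) :
    |x P| + |x Q| ≤ 1 := by
  have hconv : ConvexOn ℝ Set.univ fun x : M → ℝ => |x P| + |x Q| :=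
    (convexOn_abs_apply P).add (convexOn_abs_apply Q)
  refine convexHull_min (t := {x | x ∈ Set.univ ∧ |x P| + |x Q| ≤ 1}) ?_ (hconv.convex_le 1) hx |>.2
  rintro _ ⟨S, hS, f, -, rfl⟩
  refine ⟨trivial, ?_⟩
  by_cases hP : P ∈ S
  · have hQ : Q ∉ S := fun hQ => hS.1 hP hQ hPQ.ne hPQ
    simpa [signVector_of_notMem hQ] using abs_signVector_le S f P
  · simpa [signVector_of_notMem hP] using abs_signVector_le S f Q

lemma extremePoints_reducedPolytope (hM : ∀ P ∈ M, IsPauliObservable P) :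
    (reducedPolytope M).extremePoints ℝ = stabVectors M := by
  rw [reducedPolytope_eq hM]
  refine Set.Subset.antisymm extremePoints_convexHull_subset ?_
  rintro _ ⟨S, hS, f, hf, rfl⟩
  refine mem_extremePoints_iff_left.2 ⟨subset_convexHull ℝ _ ⟨S, hS, f, hf, rfl⟩, ?_⟩
  intro x hx y hy hxy
  obtain ⟨a, b, ha, hb, hab, h⟩ := hxy
  have hxS : ∀ P ∈ S, x P = signVector S f P := by
    intro P hP
    have h1 := congrFun h P
    have hx1 := abs_le.1 (abs_le_one_of_mem_convexHull hx P)
    have hy1 := abs_le.1 (abs_le_one_of_mem_convexHull hy P)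
    rw [signVector_of_mem hP] at h1 ⊢
    simp only [Pi.add_apply, Pi.smul_apply, smul_eq_mul] at h1
    obtain rfl : b = 1 - a := by linarith
    rcases Int.units_eq_one_or (f ⟨P, hP⟩) with hz | hz <;> rw [hz] at h1 ⊢ <;>
      simp only [Units.val_one, Units.val_neg, Int.cast_one, Int.cast_neg] at h1 ⊢
    · have : a * (1 - x P) = 0 :=
        le_antisymm (by nlinarith) (mul_nonneg ha.le (by linarith))
      rcases mul_eq_zero.1 this with h | h <;> linarith
    · have : a * (1 + x P) = 0 :=
        le_antisymm (by nlinarith) (mul_nonneg ha.le (by linarith))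
      rcases mul_eq_zero.1 this with h | h <;> linarith
  ext P
  by_cases hP : P ∈ S
  · exact hxS P hP
  · obtain ⟨Q, hQ, hadj⟩ := exists_anticommute_of_notMem hS hP
    have h1 := abs_add_abs_le_one_of_mem_convexHull hx hadj
    rw [signVector_of_notMem hP]
    have h2 : |x Q| = 1 := by
      rw [hxS Q hQ, signVector_of_mem hQ]
      rcases Int.units_eq_one_or (f ⟨Q, hQ⟩) with hz | hz <;> simp [hz]
    exact abs_nonpos_iff.1 (by linarith)

end polytope

section MoonMoser

variable {V : Type*} [DecidableEq V] (G : SimpleGraph V)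

open Classical in
/-- The maximal independent sets of the subgraph induced on `U`. -/
def maxIndepFinsets (U : Finset V) : Finset (Finset V) :=
  U.powerset.filter fun S => G.IsIndepSet S ∧ ∀ v ∈ U, v ∉ S → ∃ w ∈ S, G.Adj v w

lemma mem_maxIndepFinsets {U S : Finset V} : S ∈ maxIndepFinsets G U ↔
    S ⊆ U ∧ G.IsIndepSet S ∧ ∀ v ∈ U, v ∉ S → ∃ w ∈ S, G.Adj v w := by
  simp [maxIndepFinsets]

open Classical in
/-- The closed neighbourhood of `v` in `U`. -/
def closedNbhd (U : Finset V) (v : V) : Finset V := U.filter fun w => w = v ∨ G.Adj v w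

lemma mem_closedNbhd {U : Finset V} {v w : V} :
    w ∈ closedNbhd G U v ↔ w ∈ U ∧ (w = v ∨ G.Adj v w) := by
  simp [closedNbhd]

/-- The maximal independent sets that contain `v` are determined by their restrictions to the
complement of the closed neighbourhood of `v`. -/
lemma card_filter_mem_maxIndepFinsets_le (U : Finset V) (v : V) :
    ((maxIndepFinsets G U).filter (v ∈ ·)).card ≤
      (maxIndepFinsets G (U \ closedNbhd G U v)).card := by
  refine Finset.card_le_card_of_injOn (fun S => S.erase v) (fun S hS => ?_) ?_
  · obtain ⟨hS, hvS⟩ := Finset.mem_filter.1 hS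
    obtain ⟨hSU, hind, hmax⟩ := (mem_maxIndepFinsets G).1 hS
    refine (mem_maxIndepFinsets G).2 ⟨fun w hw => ?_, fun a ha b hb => ?_, fun w hw hwS => ?_⟩
    · obtain ⟨hwv, hwS⟩ := Finset.mem_erase.1 hw
      refine Finset.mem_sdiff.2 ⟨hSU hwS, fun h => ?_⟩
      rcases ((mem_closedNbhd G).1 h).2 with h | h
      · exact hwv h
      · exact hind hvS hwS hwv.symm h
    · exact hind (Finset.mem_of_mem_erase ha) (Finset.mem_of_mem_erase hb)
    · obtain ⟨hwU, hwN⟩ := Finset.mem_sdiff.1 hw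
      have hwN' : ¬ (w = v ∨ G.Adj v w) := fun h => hwN ((mem_closedNbhd G).2 ⟨hwU, h⟩)
      push Not at hwN'
      obtain ⟨x, hx, hwx⟩ := hmax w hwU fun h => hwS (Finset.mem_erase.2 ⟨hwN'.1, h⟩)
      refine ⟨x, Finset.mem_erase.2 ⟨?_, hx⟩, hwx⟩
      rintro rfl
      exact hwN'.2 hwx.symm
  · intro S hS T hT h
    have hS := (Finset.mem_filter.1 hS).2
    have hT := (Finset.mem_filter.1 hT).2
    rw [← Finset.insert_erase hS, ← Finset.insert_erase hT]
    exact congrArg (insert v) h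

lemma pow_three_le_three_pow (k : ℕ) : k ^ 3 ≤ 3 ^ k := by
  induction k with
  | zero => simp
  | succ k ih =>
    rcases Nat.lt_or_ge k 3 with h | h
    · interval_cases k <;> norm_num
    · rw [pow_succ 3]
      nlinarith [mul_le_mul h h (by omega) (by omega)]

/-- The Moon–Moser bound: a graph on `m` vertices has at most `3 ^ (m / 3)` maximal independent
sets. -/
lemma card_maxIndepFinsets_pow_three_le (U : Finset V) :
    (maxIndepFinsets G U).card ^ 3 ≤ 3 ^ U.card := by
  classical
  induction hk : U.card using Nat.strong_induction_on generalizing U with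
  | _ k ih =>
    subst hk
    rcases U.eq_empty_or_nonempty with rfl | hU
    · have : (maxIndepFinsets G ∅).card ≤ 1 := by
        refine (Finset.card_filter_le _ _).trans ?_
        simp
      simpa using Nat.pow_le_pow_left this 3
    obtain ⟨v, hv, hmin⟩ := U.exists_min_image (fun v => (closedNbhd G U v).card) hU
    set N := closedNbhd G U v with hN
    have hvN : v ∈ N := (mem_closedNbhd G).2 ⟨hv, Or.inl rfl⟩
    have hNU : N ⊆ U := Finset.filter_subset _ _
    have hcover : maxIndepFinsets G U ⊆ N.biUnion fun w => (maxIndepFinsets G U).filter (w ∈ ·) := by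
      intro S hS
      obtain ⟨hSU, -, hmax⟩ := (mem_maxIndepFinsets G).1 hS
      rw [Finset.mem_biUnion]
      by_cases hvS : v ∈ S
      · exact ⟨v, hvN, Finset.mem_filter.2 ⟨hS, hvS⟩⟩
      · obtain ⟨w, hw, hvw⟩ := hmax v hv hvS
        exact ⟨w, (mem_closedNbhd G).2 ⟨hSU hw, Or.inr hvw⟩, Finset.mem_filter.2 ⟨hS, hw⟩⟩
    obtain ⟨w, hw, hwmax⟩ := N.exists_max_image
      (fun w => ((maxIndepFinsets G U).filter (w ∈ ·)).card) ⟨v, hvN⟩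
    have hwU := hNU hw
    have hle : (maxIndepFinsets G U).card ≤
        N.card * (maxIndepFinsets G (U \ closedNbhd G U w)).card :=
      (Finset.card_le_card hcover).trans (Finset.card_biUnion_le_card_mul _ _ _ fun x hx =>
        (hwmax x hx).trans (card_filter_mem_maxIndepFinsets_le G U w))
    have hwN : closedNbhd G U w ⊆ U := Finset.filter_subset _ _
    have hcard := Finset.card_sdiff_of_subset hwN
    have hpos : 0 < (closedNbhd G U w).card :=
      Finset.card_pos.2 ⟨w, (mem_closedNbhd G).2 ⟨hwU, Or.inl rfl⟩⟩
    have hleU := Finset.card_le_card hwN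
    have hih := ih _ (by omega) (U \ closedNbhd G U w) rfl
    calc (maxIndepFinsets G U).card ^ 3
        ≤ (N.card * (maxIndepFinsets G (U \ closedNbhd G U w)).card) ^ 3 :=
          Nat.pow_le_pow_left hle 3
      _ = N.card ^ 3 * (maxIndepFinsets G (U \ closedNbhd G U w)).card ^ 3 := mul_pow _ _ _
      _ ≤ 3 ^ N.card * 3 ^ (U \ closedNbhd G U w).card :=
          Nat.mul_le_mul (pow_three_le_three_pow _) hih
      _ = 3 ^ (N.card + (U \ closedNbhd G U w).card) := (pow_add _ _ _).symm
      _ ≤ 3 ^ U.card := by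
          refine Nat.pow_le_pow_right (by norm_num) ?_
          have := hmin w hwU
          omega

end MoonMoser

section Lagrangian

variable {n : ℕ}

/-- The symplectic form on exponent vectors, as a bilinear form. -/
def symplecticForm (n : ℕ) : LinearMap.BilinForm (ZMod 2) (Fin n → ZMod 2 × ZMod 2) :=
  LinearMap.mk₂ (ZMod 2) stringForm
    (fun u v w => by
      simp only [stringForm, bitsForm, ← Finset.sum_add_distrib]
      exact Finset.sum_congr rfl fun i _ => by simp; ring)
    (fun c u v => by
      simp only [stringForm, bitsForm, Finset.smul_sum]
      exact Finset.sum_congr rfl fun i _ => by simp; ring)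
    (fun u v w => by
      simp only [stringForm, bitsForm, ← Finset.sum_add_distrib]
      exact Finset.sum_congr rfl fun i _ => by simp; ring)
    (fun c u v => by
      simp only [stringForm, bitsForm, Finset.smul_sum]
      exact Finset.sum_congr rfl fun i _ => by simp; ring)

lemma symplecticForm_apply (u v : Fin n → ZMod 2 × ZMod 2) :
    symplecticForm n u v = stringForm u v := rfl

lemma stringForm_comm (u v : Fin n → ZMod 2 × ZMod 2) : stringForm u v = stringForm v u :=
  Finset.sum_congr rfl fun i _ => by simp only [bitsForm]; ring

lemma stringForm_self (u : Fin n → ZMod 2 × ZMod 2) : stringForm u u = 0 := by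
  refine Finset.sum_eq_zero fun i _ => ?_
  have : ∀ a : ZMod 2 × ZMod 2, bitsForm a a = 0 := by decide
  exact this _

lemma symplecticForm_nondegenerate (n : ℕ) : (symplecticForm n).Nondegenerate := by
  have key : ∀ u : Fin n → ZMod 2 × ZMod 2, (∀ v, stringForm u v = 0) → u = 0 := by
    intro u h
    ext i
    · have := h (Pi.single i (0, 1))
      rw [stringForm, Finset.sum_eq_single i (fun j _ hj => by simp [bitsForm, hj])
        (by simp)] at this
      simpa [bitsForm] using this
    · have := h (Pi.single i (1, 0))
      rw [stringForm, Finset.sum_eq_single i (fun j _ hj => by simp [bitsForm, hj])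
        (by simp)] at this
      simpa [bitsForm] using this
  refine ⟨key, fun v h => key v fun u => ?_⟩
  rw [stringForm_comm]
  exact h u

lemma finrank_exponents (n : ℕ) :
    Module.finrank (ZMod 2) (Fin n → ZMod 2 × ZMod 2) = 2 * n := by
  rw [Module.finrank_pi_fintype]
  simp [mul_comm]

/-- Isotropic subspaces of maximal dimension. -/
def lagrangians (n : ℕ) : Set (Submodule (ZMod 2) (Fin n → ZMod 2 × ZMod 2)) :=
  {L | (∀ u ∈ L, ∀ v ∈ L, stringForm u v = 0) ∧ Module.finrank (ZMod 2) L = n}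

lemma exists_lagrangian {W : Set (Fin n → ZMod 2 × ZMod 2)}
    (hW : ∀ u ∈ W, ∀ v ∈ W, stringForm u v = 0) :
    ∃ L ∈ lagrangians n, W ⊆ L := by
  obtain ⟨A, hWA, hA⟩ := (Set.toFinite {A : Set (Fin n → ZMod 2 × ZMod 2) |
    ∀ u ∈ A, ∀ v ∈ A, stringForm u v = 0}).exists_le_maximal hW
  have hAiso : ∀ u ∈ A, ∀ v ∈ A, stringForm u v = 0 := hA.1
  have hmem : ∀ v, v ∈ A ↔ ∀ u ∈ A, symplecticForm n u v = 0 := by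
    refine fun v => ⟨fun hv u hu => hAiso u hu v hv, fun h => ?_⟩
    refine hA.2 (y := insert v A) ?_ (Set.subset_insert v A) (Set.mem_insert v A)
    rintro a (rfl | ha) b (rfl | hb)
    · exact stringForm_self _
    · rw [stringForm_comm]; exact h b hb
    · exact h a ha
    · exact hAiso a ha b hb
  let L : Submodule (ZMod 2) (Fin n → ZMod 2 × ZMod 2) :=
    { carrier := A
      add_mem' := fun {a b} ha hb => by
        rw [hmem] at ha hb ⊢
        intro u hu
        rw [map_add, ha u hu, hb u hu, add_zero]
      zero_mem' := by
        rw [hmem]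
        intro u _
        exact map_zero _
      smul_mem' := fun c a ha => by
        rw [hmem] at ha ⊢
        intro u hu
        rw [map_smul, ha u hu, smul_zero] }
  have hL : (symplecticForm n).orthogonal L = L := by
    ext v
    rw [LinearMap.BilinForm.mem_orthogonal_iff]
    exact (hmem v).symm
  have hfin := LinearMap.BilinForm.finrank_orthogonal (symplecticForm_nondegenerate n) L
  have hle := L.finrank_le
  rw [finrank_exponents] at hfin hle
  rw [hL] at hfin
  exact ⟨L, ⟨hAiso, by omega⟩, hWA⟩

/-- The linearly independent isotropic `k`-tuples. -/
def isotropicTuples (n k : ℕ) : Type :=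
  {s : Fin k → Fin n → ZMod 2 × ZMod 2 //
    LinearIndependent (ZMod 2) s ∧ ∀ i j, stringForm (s i) (s j) = 0}

instance (n k : ℕ) : Finite (isotropicTuples n k) :=
  inferInstanceAs (Finite {s : Fin k → Fin n → ZMod 2 × ZMod 2 //
    LinearIndependent (ZMod 2) s ∧ ∀ i j, stringForm (s i) (s j) = 0})

lemma card_isotropicTuples_succ_le (n k : ℕ) :
    Nat.card (isotropicTuples n (k + 1)) ≤ Nat.card (isotropicTuples n k) * 2 ^ (2 * n - k) := by
  have := Fintype.ofFinite (isotropicTuples n k)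
  let F (s : isotropicTuples n k) : Submodule (ZMod 2) (Fin n → ZMod 2 × ZMod 2) :=
    (symplecticForm n).orthogonal (Submodule.span (ZMod 2) (Set.range s.1))
  have hF : ∀ s, Nat.card (F s) = 2 ^ (2 * n - k) := by
    intro s
    rw [Module.natCard_eq_pow_finrank (K := ZMod 2),
      LinearMap.BilinForm.finrank_orthogonal (symplecticForm_nondegenerate n),
      finrank_exponents, finrank_span_eq_card s.2.1, Fintype.card_fin, Nat.card_zmod]
  let e : isotropicTuples n (k + 1) → Σ s : isotropicTuples n k, F s := fun s =>
    ⟨⟨Fin.tail s.1, s.2.1.comp _ (Fin.succ_injective k), fun i j => s.2.2 _ _⟩, s.1 0, by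
      rw [LinearMap.BilinForm.mem_orthogonal_iff]
      intro u hu
      have hle : Submodule.span (ZMod 2) (Set.range (Fin.tail s.1)) ≤
          LinearMap.ker ((symplecticForm n).flip (s.1 0)) := by
        rw [Submodule.span_le]
        rintro _ ⟨i, rfl⟩
        exact s.2.2 _ _
      exact hle hu⟩
  have he : Function.Injective e := by
    intro s t h
    have h1 : Fin.tail s.1 = Fin.tail t.1 := congrArg (fun x => x.1.1) h
    have h2 : s.1 0 = t.1 0 :=
      congrArg (fun x : Σ s : isotropicTuples n k, F s => (x.2 : Fin n → ZMod 2 × ZMod 2)) h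
    refine Subtype.ext ?_
    rw [← Fin.cons_self_tail s.1, ← Fin.cons_self_tail t.1, h1, h2]
  refine (Nat.card_le_card_of_injective e he).trans ?_
  rw [Nat.card_sigma]
  simp [hF, Nat.card_eq_fintype_card]

lemma card_isotropicTuples_sq_le (n k : ℕ) (hk : k ≤ n) :
    Nat.card (isotropicTuples n k) ^ 2 * 2 ^ (k * (k - 1)) ≤ 2 ^ (4 * n * k) := by
  induction k with
  | zero =>
    have : Subsingleton (isotropicTuples n 0) := ⟨fun s t => Subtype.ext (Subsingleton.elim _ _)⟩
    simpa using Finite.card_le_one_iff_subsingleton.2 this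
  | succ k ih =>
    have h := card_isotropicTuples_succ_le n k
    have h2 := ih (by omega)
    have he : 2 * (2 * n - k) + (k + 1) * (k + 1 - 1) = 4 * n + k * (k - 1) := by
      rcases k with _ | k
      · simp; ring
      · obtain ⟨m, rfl⟩ : ∃ m, n = m + k + 1 := ⟨n - (k + 1), by omega⟩
        have : 2 * (m + k + 1) - (k + 1) = 2 * m + k + 1 := by omega
        rw [this]
        simp only [Nat.add_sub_cancel]
        ring
    calc Nat.card (isotropicTuples n (k + 1)) ^ 2 * 2 ^ ((k + 1) * (k + 1 - 1))
        ≤ (Nat.card (isotropicTuples n k) * 2 ^ (2 * n - k)) ^ 2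
            * 2 ^ ((k + 1) * (k + 1 - 1)) := by gcongr
      _ = Nat.card (isotropicTuples n k) ^ 2
            * 2 ^ (2 * (2 * n - k) + (k + 1) * (k + 1 - 1)) := by
          rw [mul_pow, pow_add, ← pow_mul, mul_comm (2 * n - k) 2]; ring
      _ = Nat.card (isotropicTuples n k) ^ 2 * 2 ^ (k * (k - 1)) * 2 ^ (4 * n) := by
          rw [he, pow_add]; ring
      _ ≤ 2 ^ (4 * n * k) * 2 ^ (4 * n) := by gcongr
      _ = 2 ^ (4 * n * (k + 1)) := by rw [← pow_add]; ring_nf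

lemma ncard_lagrangians_mul_le (n : ℕ) :
    (lagrangians n).ncard * 2 ^ (n * (n - 1)) ≤ Nat.card (isotropicTuples n n) := by
  have := Fintype.ofFinite (lagrangians n)
  let e : (Σ L : lagrangians n, {s : Fin n → L.1 // LinearIndependent (ZMod 2) s}) →
      isotropicTuples n n := fun x =>
    ⟨fun i => x.2.1 i, x.2.2.map' (Submodule.subtype _) (Submodule.ker_subtype _),
      fun i j => x.1.2.1 _ (x.2.1 i).2 _ (x.2.1 j).2⟩
  have hspan : ∀ x, Submodule.span (ZMod 2) (Set.range (e x).1) = x.1.1 := by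
    rintro ⟨L, s⟩
    refine Submodule.eq_of_le_of_finrank_eq ?_ ?_
    · rw [Submodule.span_le]
      rintro _ ⟨i, rfl⟩
      exact (s.1 i).2
    · rw [finrank_span_eq_card (e ⟨L, s⟩).2.1, Fintype.card_fin, L.2.2]
  have he : Function.Injective e := by
    rintro ⟨L, s⟩ ⟨L', s'⟩ h
    obtain rfl : L = L' := Subtype.ext ((hspan ⟨L, s⟩).symm.trans ((by rw [h]) : _ = _) |>.trans
      (hspan ⟨L', s'⟩))
    congr 1
    refine Subtype.ext (funext fun i => Subtype.ext ?_)
    exact congrFun (congrArg Subtype.val h) i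
  refine le_trans ?_ (Nat.card_le_card_of_injective e he)
  rw [Nat.card_sigma, ← Nat.card_coe_set_eq, Nat.card_eq_fintype_card, ← smul_eq_mul]
  refine Finset.card_nsmul_le_sum Finset.univ _ _ fun L _ => ?_
  rw [card_linearIndependent L.2.2.ge, L.2.2, ZMod.card]
  calc 2 ^ (n * (n - 1)) = ∏ _i : Fin n, 2 ^ (n - 1) := by
        rw [Finset.prod_const, Finset.card_univ, Fintype.card_fin, ← pow_mul, mul_comm]
    _ ≤ ∏ i : Fin n, (2 ^ n - 2 ^ (i : ℕ)) := Finset.prod_le_prod' fun i _ => by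
        have hi := i.2
        have h1 : 2 ^ (i : ℕ) ≤ 2 ^ (n - 1) := Nat.pow_le_pow_right (by norm_num) (by omega)
        have h2 : 2 ^ n = 2 ^ (n - 1) * 2 := by
          rw [← pow_succ, Nat.sub_add_cancel (by omega)]
        omega

lemma ncard_lagrangians_sq_le (n : ℕ) : (lagrangians n).ncard ^ 2 ≤ 2 ^ (n ^ 2 + 3 * n) := by
  have h1 := Nat.pow_le_pow_left (ncard_lagrangians_mul_le n) 2
  have h2 := card_isotropicTuples_sq_le n n le_rfl
  have h3 : (lagrangians n).ncard ^ 2 * 2 ^ (3 * (n * (n - 1))) ≤ 2 ^ (4 * n * n) := by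
    refine le_trans ?_ ((Nat.mul_le_mul_right _ h1).trans h2)
    rw [mul_pow, mul_assoc, ← pow_mul, ← pow_add]
    exact le_of_eq (by ring_nf)
  have h4 : 4 * n * n = n ^ 2 + 3 * n + 3 * (n * (n - 1)) := by
    rcases n with _ | n
    · rfl
    · simp only [Nat.add_sub_cancel]; ring
  rw [h4, pow_add] at h3
  exact Nat.le_of_mul_le_mul_right h3 (by positivity)

end Lagrangian

section counting

variable {n : ℕ} {M : Finset (QubitOp n)}

lemma ncard_maxIndepSets_pow_three_le (M : Finset (QubitOp n)) :
    (maxIndepSets M).ncard ^ 3 ≤ 3 ^ M.card := by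
  classical
  have h := card_maxIndepFinsets_pow_three_le (frustrationGraph M) Finset.univ
  rw [Finset.card_univ, Fintype.card_coe] at h
  refine (Nat.pow_le_pow_left ?_ 3).trans h
  rw [← Set.ncard_coe_finset]
  refine Set.ncard_le_ncard_of_injOn (fun S => S.toFinset) (fun S hS => ?_)
    (fun S _ T _ h => Set.toFinset_inj.1 h) (Finset.finite_toSet _)
  rw [Finset.mem_coe, mem_maxIndepFinsets]
  refine ⟨Finset.subset_univ _, by simpa using hS.1, fun v _ hv => ?_⟩
  obtain ⟨w, hw, h⟩ := exists_anticommute_of_notMem hS (by simpa using hv)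
  exact ⟨w, by simpa using hw, h⟩

lemma ncard_maxIndepSets_le_ncard_lagrangians (hM : ∀ P ∈ M, IsPauliObservable P) :
    (maxIndepSets M).ncard ≤ (lagrangians n).ncard := by
  choose b hb using fun P : M => (hM P P.2).exists_pauliOf
  have hcomm : ∀ P Q : M, stringForm (b P) (b Q) = 0 ↔
      (P : QubitOp n) * (Q : QubitOp n) = (Q : QubitOp n) * (P : QubitOp n) := by
    intro P Q
    have h1 : (P : QubitOp n) * (Q : QubitOp n) =
        zmodSign (stringForm (b P) (b Q)) • ((Q : QubitOp n) * (P : QubitOp n)) := by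
      have h := pauliOf_mul_comm (b P) (b Q)
      rcases hb P with hP | hP <;> rcases hb Q with hQ | hQ <;> rw [hP, hQ] <;> simp [h]
    refine ⟨fun h => by rw [h1, h]; simp [zmodSign], fun h => ?_⟩
    by_contra h0
    refine (hM P P.2).not_anticommute (hM Q Q.2) h ?_
    conv_lhs => rw [h1]
    simp [zmodSign, h0]
  have hex : ∀ S ∈ maxIndepSets M, ∃ L ∈ lagrangians n, b '' S ⊆ L := by
    intro S hS
    apply exists_lagrangian
    rintro _ ⟨P, hP, rfl⟩ _ ⟨Q, hQ, rfl⟩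
    exact (hcomm P Q).2 (commute_of_isIndepSet hM hS.1 hP hQ)
  choose! F hF hFS using hex
  refine Set.ncard_le_ncard_of_injOn F hF ?_ (Set.toFinite _)
  have hdet : ∀ S ∈ maxIndepSets M, ∀ P, P ∈ S ↔ b P ∈ F S := by
    intro S hS P
    refine ⟨fun h => hFS S hS ⟨P, h, rfl⟩, fun h => ?_⟩
    by_contra hP
    obtain ⟨Q, hQ, hadj⟩ := exists_anticommute_of_notMem hS hP
    exact (hM P P.2).not_anticommute (hM Q Q.2)
      ((hcomm P Q).1 ((hF S hS).1 _ h _ (hFS S hS ⟨Q, hQ, rfl⟩))) hadj.2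
  intro S hS T hT h
  ext P
  rw [hdet S hS, hdet T hT, h]

lemma ncard_admissibleSigns_le_two_pow_card (S : Set M) :
    (admissibleSigns S).ncard ≤ 2 ^ M.card := by
  classical
  refine (Set.ncard_le_card _).trans ?_
  rw [Nat.card_eq_fintype_card, Fintype.card_fun, Fintype.card_units_int]
  refine Nat.pow_le_pow_right (by norm_num) ?_
  simpa using set_fintype_card_le_univ S

lemma dotProduct_eq_zero_of_eigenvalue_ne {A : QubitOp n} (hA : A.conjTranspose = A)
    {φ ψ : (Fin n → Fin 2) → ℂ} {y z : ℤˣ} (hyz : y ≠ z)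
    (hφ : A.mulVec φ = ((y : ℤ) : ℂ) • φ) (hψ : A.mulVec ψ = ((z : ℤ) : ℂ) • ψ) :
    star φ ⬝ᵥ ψ = 0 := by
  have h := star_dotProduct_mulVec_comm hA φ ψ
  rw [hφ, hψ, star_smul, smul_dotProduct, dotProduct_smul] at h
  simp only [Complex.star_def, map_intCast, smul_eq_mul] at h
  rw [← sub_eq_zero, ← sub_mul] at h
  refine (mul_eq_zero.1 h).resolve_left fun h0 => hyz ?_
  exact Units.ext (by exact_mod_cast sub_eq_zero.1 h0)

lemma ncard_admissibleSigns_le_two_pow_qubits (hM : ∀ P ∈ M, IsPauliObservable P) {S : Set M}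
    (hS : (frustrationGraph M).IsIndepSet S) : (admissibleSigns S).ncard ≤ 2 ^ n := by
  classical
  choose ψ hψ heig _ using fun f : admissibleSigns S => exists_state_of_admissible hM hS f.2
  let e : admissibleSigns S → EuclideanSpace ℂ (Fin n → Fin 2) := fun f => WithLp.toLp 2 (ψ f)
  have hinner : ∀ f g, inner ℂ (e f) (e g) = star (ψ f) ⬝ᵥ ψ g := fun f g => by
    rw [EuclideanSpace.inner_eq_star_dotProduct, dotProduct_comm]
  have hli : LinearIndependent ℂ e := by
    refine linearIndependent_of_ne_zero_of_inner_eq_zero (fun f h => ?_) fun f g hfg => ?_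
    · have := hinner f f
      rw [h, inner_zero_left, hψ] at this
      exact zero_ne_one this
    · change inner ℂ (e f) (e g) = 0
      rw [hinner]
      obtain ⟨P, hP⟩ := Function.ne_iff.1 (Subtype.coe_injective.ne hfg)
      exact dotProduct_eq_zero_of_eigenvalue_ne (hM _ P.1.2).conjTranspose hP (heig f P) (heig g P)
  have := hli.fintype_card_le_finrank
  rw [← Nat.card_coe_set_eq, Nat.card_eq_fintype_card]
  simpa using this

lemma stabVectors_eq_biUnion (M : Finset (QubitOp n)) :
    stabVectors M = ⋃ S ∈ maxIndepSets M, signVector S '' admissibleSigns S := by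
  ext v
  simp only [Set.mem_iUnion, Set.mem_image, exists_prop]
  constructor
  · rintro ⟨S, hS, f, hf, rfl⟩
    exact ⟨S, hS, f, hf, rfl⟩
  · rintro ⟨S, hS, f, hf, rfl⟩
    exact ⟨S, hS, f, hf, rfl⟩

lemma finite_stabVectors (M : Finset (QubitOp n)) : (stabVectors M).Finite := by
  rw [stabVectors_eq_biUnion]
  exact (Set.toFinite _).biUnion fun S _ => (Set.toFinite _).image _

lemma ncard_stabVectors_le (hM : ∀ P ∈ M, IsPauliObservable P) :
    (stabVectors M).ncard ≤ (maxIndepSets M).ncard * 2 ^ min n M.card := by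
  classical
  have h : stabVectors M = ((Set.toFinite (maxIndepSets M)).toFinset.biUnion fun S =>
      ((Set.toFinite (admissibleSigns S)).image (signVector S)).toFinset : Finset (M → ℝ)) := by
    rw [stabVectors_eq_biUnion]
    ext v
    simp
  rw [h, Set.ncard_coe_finset, Set.ncard_eq_toFinset_card (maxIndepSets M)]
  refine Finset.card_biUnion_le_card_mul _ _ _ fun S hS => ?_
  have hS' : S ∈ maxIndepSets M := by simpa using hS
  rw [← Set.ncard_eq_toFinset_card (signVector S '' admissibleSigns S)]
  refine (Set.ncard_image_le (Set.toFinite _)).trans ?_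
  rcases min_cases n M.card with ⟨h, -⟩ | ⟨h, -⟩ <;> rw [h]
  · exact ncard_admissibleSigns_le_two_pow_qubits hM hS'.1
  · exact ncard_admissibleSigns_le_two_pow_card S

lemma two_rpow_logb_three_mul (x : ℝ) : (2 : ℝ) ^ (Real.logb 2 3 * x) = 3 ^ x := by
  rw [Real.rpow_mul (by norm_num), Real.rpow_logb (by norm_num) (by norm_num) (by norm_num)]

lemma half_add_two_div_mul_sq (n : ℕ) :
    (1 / 2 + 2 / (n : ℝ)) * (n : ℝ) ^ 2 = (n : ℝ) ^ 2 / 2 + 2 * n := by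
  rcases eq_or_ne (n : ℝ) 0 with h | h
  · simp [h]
  · field_simp

lemma ncard_maxIndepSets_le_rpow (hM : ∀ P ∈ M, IsPauliObservable P) :
    ((maxIndepSets M).ncard : ℝ) ≤ (2 : ℝ) ^ min (Real.logb 2 3 / 3 * (M.card : ℝ))
      ((1 / 2 + 2 / (n : ℝ)) * (n : ℝ) ^ 2) := by
  rcases min_cases (Real.logb 2 3 / 3 * (M.card : ℝ)) ((1 / 2 + 2 / (n : ℝ)) * (n : ℝ) ^ 2)
    with ⟨h, -⟩ | ⟨h, -⟩ <;> rw [h]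
  · refine le_of_pow_le_pow_left₀ three_ne_zero (by positivity) ?_
    rw [← Real.rpow_mul_natCast (by norm_num),
      show Real.logb 2 3 / 3 * (M.card : ℝ) * (3 : ℕ) = Real.logb 2 3 * M.card by push_cast; ring,
      two_rpow_logb_three_mul, Real.rpow_natCast]
    exact_mod_cast ncard_maxIndepSets_pow_three_le M
  · rw [half_add_two_div_mul_sq]
    refine le_of_pow_le_pow_left₀ two_ne_zero (by positivity) ?_
    have h1 := (Nat.pow_le_pow_left (ncard_maxIndepSets_le_ncard_lagrangians hM) 2).trans
      (ncard_lagrangians_sq_le n)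
    have h2 : (n ^ 2 + 3 * n) ≤ n ^ 2 + 4 * n := by omega
    have h3 := h1.trans (Nat.pow_le_pow_right (by norm_num) h2)
    rw [← Real.rpow_mul_natCast (by norm_num),
      show ((n : ℝ) ^ 2 / 2 + 2 * n) * (2 : ℕ) = ((n ^ 2 + 4 * n : ℕ) : ℝ) by push_cast; ring,
      Real.rpow_natCast]
    exact_mod_cast h3

lemma ncard_stabVectors_le_rpow (hM : ∀ P ∈ M, IsPauliObservable P) :
    ((stabVectors M).ncard : ℝ) ≤ (2 : ℝ) ^ (((min n M.card : ℕ) : ℝ) +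
      min (Real.logb 2 3 / 3 * (M.card : ℝ)) ((1 / 2 + 2 / (n : ℝ)) * (n : ℝ) ^ 2)) := by
  rw [Real.rpow_add (by norm_num), Real.rpow_natCast, mul_comm]
  calc ((stabVectors M).ncard : ℝ) ≤ ((maxIndepSets M).ncard : ℝ) * 2 ^ min n M.card := by
        exact_mod_cast ncard_stabVectors_le hM
    _ ≤ _ := by gcongr; exact ncard_maxIndepSets_le_rpow hM

end counting

section localPaulis

variable {n : ℕ}

/-- The exponents of the three single-qubit Pauli operators other than the identity. -/
def axisBits : Fin 3 → ZMod 2 × ZMod 2 := ![(1, 0), (1, 1), (0, 1)]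

lemma axisBits_injective : Function.Injective axisBits := by decide

lemma bitsForm_axisBits (k l : Fin 3) :
    bitsForm (axisBits k) (axisBits l) = if k = l then 0 else 1 := by
  revert k l; decide

/-- The Pauli operator with axis `k` acting on qubit `i`. -/
def sitePauli (i : Fin n) (k : Fin 3) : QubitOp n := pauliOf (Pi.single i (axisBits k))

lemma sitePauli_eq_localPauli (i : Fin n) (k : Fin 3) :
    sitePauli i k = localPauli i (labelOfBits (axisBits k)) := by
  rw [sitePauli, localPauli, pauliOf]
  congr 1
  ext j
  by_cases h : j = i
  · subst h; simp
  · simp [h, labelOfBits]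

lemma localPaulis_eq_image (n : ℕ) [DecidableEq (QubitOp n)] :
    localPaulis n = Finset.univ.image fun x : Fin n × Fin 3 => sitePauli x.1 x.2 := by
  ext P
  simp only [localPaulis, Finset.mem_biUnion, Finset.mem_univ, true_and, Finset.mem_insert,
    Finset.mem_singleton, Finset.mem_image, Prod.exists, sitePauli_eq_localPauli,
    Fin.exists_fin_succ, Fin.exists_fin_zero, or_false]
  simp [axisBits, labelOfBits, eq_comm]

lemma sitePauli_injective : Function.Injective fun x : Fin n × Fin 3 => sitePauli x.1 x.2 := by
  rintro ⟨i, k⟩ ⟨j, l⟩ h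
  have h1 : (Pi.single i (axisBits k) : Fin n → ZMod 2 × ZMod 2) = Pi.single j (axisBits l) :=
    pauliOf_injective_up_to_phase (c := 1) (d := 1) one_ne_zero (by simpa [sitePauli] using h)
  have h0 : ∀ k, axisBits k ≠ 0 := by decide
  have hij : i = j := by
    by_contra hij
    have := congrFun h1 i
    rw [Pi.single_eq_same, Pi.single_eq_of_ne hij] at this
    exact h0 k this
  subst hij
  exact Prod.ext rfl (axisBits_injective (Pi.single_injective i h1))

lemma card_localPaulis (n : ℕ) : (localPaulis n).card = 3 * n := by
  classical
  rw [localPaulis_eq_image, Finset.card_image_of_injective _ sitePauli_injective]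
  simp [mul_comm]

lemma mem_localPaulis {P : QubitOp n} : P ∈ localPaulis n ↔ ∃ i k, P = sitePauli i k := by
  classical
  rw [localPaulis_eq_image, Finset.mem_image]
  constructor
  · rintro ⟨x, -, rfl⟩
    exact ⟨x.1, x.2, rfl⟩
  · rintro ⟨i, k, rfl⟩
    exact ⟨(i, k), Finset.mem_univ _, rfl⟩

lemma isPauliObservable_of_mem_localPaulis {P : QubitOp n} (hP : P ∈ localPaulis n) :
    IsPauliObservable P := by
  obtain ⟨i, k, rfl⟩ := mem_localPaulis.1 hP
  exact ⟨_, Or.inl rfl⟩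

/-- The element `sitePauli i k` of `localPaulis n`. -/
def siteElement (i : Fin n) (k : Fin 3) : localPaulis n :=
  ⟨sitePauli i k, mem_localPaulis.2 ⟨i, k, rfl⟩⟩

lemma siteElement_inj {i j : Fin n} {k l : Fin 3} :
    siteElement i k = siteElement j l ↔ i = j ∧ k = l := by
  rw [← Prod.mk.injEq, ← sitePauli_injective.eq_iff, Subtype.ext_iff]
  rfl

lemma exists_siteElement (P : localPaulis n) : ∃ i k, P = siteElement i k := by
  obtain ⟨i, k, h⟩ := mem_localPaulis.1 P.2
  exact ⟨i, k, Subtype.ext h⟩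

lemma frustrationGraph_localPaulis_adj {i j : Fin n} {k l : Fin 3} :
    (frustrationGraph (localPaulis n)).Adj (siteElement i k) (siteElement j l) ↔
      i = j ∧ k ≠ l := by
  have hform : stringForm (Pi.single i (axisBits k) : Fin n → ZMod 2 × ZMod 2)
      (Pi.single j (axisBits l)) = if i = j ∧ k ≠ l then 1 else 0 := by
    rw [stringForm, Finset.sum_eq_single i (fun m _ hm => by simp [bitsForm, hm]) (by simp)]
    by_cases hij : i = j
    · subst hij
      rw [Pi.single_eq_same, Pi.single_eq_same, bitsForm_axisBits]
      by_cases hkl : k = l <;> simp [hkl]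
    · rw [Pi.single_eq_of_ne hij]
      simp [bitsForm, hij]
  have hmul := pauliOf_mul_comm (Pi.single i (axisBits k) : Fin n → ZMod 2 × ZMod 2)
    (Pi.single j (axisBits l))
  rw [hform] at hmul
  constructor
  · rintro ⟨-, h⟩
    by_contra hne
    refine IsPauliObservable.not_anticommute
      (isPauliObservable_of_mem_localPaulis (siteElement i k).2)
      (isPauliObservable_of_mem_localPaulis (siteElement j l).2) ?_ h
    rw [if_neg hne] at hmul
    rwa [zmodSign, if_pos rfl, one_smul] at hmul
  · intro h
    refine ⟨fun h2 => h.2 (siteElement_inj.1 h2).2, ?_⟩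
    rw [if_pos h] at hmul
    rwa [zmodSign, if_neg one_ne_zero, neg_one_smul] at hmul

lemma pauliString_mulVec_prod (s : Fin n → PauliLabel) (φ : Fin n → Fin 2 → ℂ) :
    (pauliString s).mulVec (fun x => ∏ i, φ i (x i)) =
      fun x => ∏ i, ((pauliMatrix (s i)).mulVec (φ i)) (x i) := by
  ext x
  simp only [Matrix.mulVec, dotProduct, pauliString, Matrix.of_apply, ← Finset.prod_mul_distrib]
  rw [Finset.prod_univ_sum]
  simp

lemma exists_eigenvector_axis (k : Fin 3) (z : ℤˣ) : ∃ φ : Fin 2 → ℂ, (∃ x, φ x ≠ 0) ∧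
    (pauliMatrix (labelOfBits (axisBits k))).mulVec φ = ((z : ℤ) : ℂ) • φ := by
  fin_cases k
  · refine ⟨![1, ((z : ℤ) : ℂ)], ⟨0, by simp⟩, ?_⟩
    ext x
    fin_cases x <;> simp [axisBits, labelOfBits, pauliMatrix, unit_int_cast_mul_self]
  · refine ⟨![1, Complex.I * ((z : ℤ) : ℂ)], ⟨0, by simp⟩, ?_⟩
    have h := unit_int_cast_mul_self z
    ext x
    fin_cases x <;> simp [axisBits, labelOfBits, pauliMatrix]
    · linear_combination (-((z : ℤ) : ℂ)) * Complex.I_mul_I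
    · linear_combination (-Complex.I) * h
  · rcases Int.units_eq_one_or z with rfl | rfl
    · refine ⟨![1, 0], ⟨0, by simp⟩, ?_⟩
      ext x
      fin_cases x <;> simp [axisBits, labelOfBits, pauliMatrix]
    · refine ⟨![0, 1], ⟨1, by simp⟩, ?_⟩
      ext x
      fin_cases x <;> simp [axisBits, labelOfBits, pauliMatrix]

lemma exists_product_eigenvector (a : Fin n → Fin 3) (z : Fin n → ℤˣ) :
    ∃ ψ : (Fin n → Fin 2) → ℂ, ψ ≠ 0 ∧
      ∀ i, (sitePauli i (a i)).mulVec ψ = ((z i : ℤ) : ℂ) • ψ := by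
  choose φ hφ heig using fun i => exists_eigenvector_axis (a i) (z i)
  choose x hx using hφ
  refine ⟨fun y => ∏ i, φ i (y i), fun h => ?_, fun i => ?_⟩
  · exact Finset.prod_ne_zero_iff.2 (fun i _ => hx i) (congrFun h x)
  · rw [sitePauli, pauliOf, pauliString_mulVec_prod]
    ext y
    rw [Pi.smul_apply, smul_eq_mul, ← Finset.mul_prod_erase _ _ (Finset.mem_univ i),
      ← Finset.mul_prod_erase _ (fun i => φ i (y i)) (Finset.mem_univ i), ← mul_assoc]
    congr 1
    · rw [Pi.single_eq_same, heig]; rfl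
    · refine Finset.prod_congr rfl fun j hj => ?_
      rw [Pi.single_eq_of_ne (Finset.ne_of_mem_erase hj)]
      simp [labelOfBits, pauliMatrix]

/-- One Pauli operator per qubit. -/
def siteChoice (a : Fin n → Fin 3) : Set (localPaulis n) := Set.range fun i => siteElement i (a i)

lemma siteElement_mem_siteChoice {a : Fin n → Fin 3} {i : Fin n} {k : Fin 3} :
    siteElement i k ∈ siteChoice a ↔ a i = k := by
  constructor
  · rintro ⟨j, hj⟩
    obtain ⟨rfl, h⟩ := siteElement_inj.1 hj
    exact h
  · rintro rfl
    exact ⟨i, rfl⟩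

lemma siteChoice_mem_maxIndepSets (a : Fin n → Fin 3) :
    siteChoice a ∈ maxIndepSets (localPaulis n) := by
  refine ⟨?_, fun T hT hle P hP => ?_⟩
  · rintro _ ⟨i, rfl⟩ _ ⟨j, rfl⟩ _ hadj
    obtain ⟨rfl, h⟩ := frustrationGraph_localPaulis_adj.1 hadj
    exact h rfl
  · obtain ⟨i, k, rfl⟩ := exists_siteElement P
    rw [siteElement_mem_siteChoice]
    by_contra hne
    have hadj := frustrationGraph_localPaulis_adj.2 (⟨rfl, hne⟩ : i = i ∧ a i ≠ k)
    exact hT (hle (siteElement_mem_siteChoice.2 rfl)) hP hadj.ne hadj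

lemma six_pow_le_ncard_stabVectors (n : ℕ) : 6 ^ n ≤ (stabVectors (localPaulis n)).ncard := by
  classical
  have hsite : ∀ (a : Fin n → Fin 3) (P : siteChoice a), ∃ i, siteElement i (a i) = P :=
    fun a P => P.2
  choose q hq using hsite
  let v (x : (Fin n → Fin 3) × (Fin n → ℤˣ)) : localPaulis n → ℝ :=
    signVector (siteChoice x.1) fun P => x.2 (q x.1 P)
  have hv : ∀ x i k, v x (siteElement i k) = if x.1 i = k then ((x.2 i : ℤ) : ℝ) else 0 := by
    intro x i k
    by_cases h : x.1 i = k
    · have hmem := siteElement_mem_siteChoice.2 h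
      have hqi : q x.1 ⟨_, hmem⟩ = i := (siteElement_inj.1 (hq x.1 ⟨_, hmem⟩)).1
      rw [if_pos h]
      simp only [v]
      rw [signVector_of_mem hmem, hqi]
    · rw [if_neg h]
      exact signVector_of_notMem fun h2 => h (siteElement_mem_siteChoice.1 h2)
  have hinj : Function.Injective v := by
    intro x y h
    have key : ∀ i, x.1 i = y.1 i ∧ x.2 i = y.2 i := by
      intro i
      have h1 := congrFun h (siteElement i (x.1 i))
      rw [hv, hv, if_pos rfl] at h1
      by_cases h2 : y.1 i = x.1 i
      · rw [if_pos h2] at h1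
        exact ⟨h2.symm, Units.ext (by exact_mod_cast h1)⟩
      · rw [if_neg h2] at h1
        exact absurd (by exact_mod_cast h1) (x.2 i).ne_zero
    exact Prod.ext (funext fun i => (key i).1) (funext fun i => (key i).2)
  have hmem : Set.range v ⊆ stabVectors (localPaulis n) := by
    rintro _ ⟨x, rfl⟩
    refine ⟨_, siteChoice_mem_maxIndepSets x.1, _, ?_, rfl⟩
    obtain ⟨ψ, hψ, heig⟩ := exists_product_eigenvector x.1 x.2
    refine mem_admissibleSigns_of_eigenvector hψ fun P => ?_
    have := heig (q x.1 P)
    rwa [show sitePauli (q x.1 P) (x.1 (q x.1 P)) = ((P : localPaulis n) : QubitOp n) from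
      congrArg Subtype.val (hq x.1 P)] at this
  have hcard : (Set.range v).ncard = 6 ^ n := by
    rw [← Set.image_univ, Set.ncard_image_of_injective _ hinj, Set.ncard_univ,
      Nat.card_eq_fintype_card]
    simp [← mul_pow]
  exact hcard ▸ Set.ncard_le_ncard hmem (finite_stabVectors _)

lemma logb_two_three_le_two : Real.logb 2 3 ≤ 2 := by
  rw [Real.logb_le_iff_le_rpow (by norm_num) (by norm_num)]
  norm_num

lemma two_rpow_add_logb (n : ℕ) :
    (2 : ℝ) ^ ((n : ℝ) + Real.logb 2 3 / 3 * ((3 * n : ℕ) : ℝ)) = 6 ^ n := by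
  rw [Real.rpow_add (by norm_num), Real.rpow_natCast,
    show Real.logb 2 3 / 3 * ((3 * n : ℕ) : ℝ) = Real.logb 2 3 * n by push_cast; ring,
    two_rpow_logb_three_mul, Real.rpow_natCast, ← mul_pow]
  norm_num

lemma localPaulis_exponent_eq (n : ℕ) :
    ((min n (localPaulis n).card : ℕ) : ℝ) + min (Real.logb 2 3 / 3 * ((localPaulis n).card : ℝ))
      ((1 / 2 + 2 / (n : ℝ)) * (n : ℝ) ^ 2) =
    (n : ℝ) + Real.logb 2 3 / 3 * ((3 * n : ℕ) : ℝ) := by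
  rw [card_localPaulis, min_eq_left (by omega : n ≤ 3 * n), min_eq_left]
  rw [half_add_two_div_mul_sq]
  have h := mul_le_mul_of_nonneg_right logb_two_three_le_two (Nat.cast_nonneg (α := ℝ) n)
  push_cast
  nlinarith [sq_nonneg (n : ℝ)]

lemma ncard_stabVectors_localPaulis (n : ℕ) :
    ((stabVectors (localPaulis n)).ncard : ℝ) =
      (2 : ℝ) ^ ((n : ℝ) + Real.logb 2 3 / 3 * ((3 * n : ℕ) : ℝ)) := by
  apply le_antisymm
  · rw [← localPaulis_exponent_eq]
    exact ncard_stabVectors_le_rpow fun P hP => isPauliObservable_of_mem_localPaulis hP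
  · rw [two_rpow_add_logb]
    exact_mod_cast six_pow_le_ncard_stabVectors n

end localPaulis

end

theorem mainTheorem1 :
    (∀ (n : ℕ) (M : Finset (QubitOp n)), (∀ P ∈ M, IsPauliObservable P) →
      reducedPolytope M = convexHull ℝ (stabVectors M) ∧
      (reducedPolytope M).extremePoints ℝ = stabVectors M) ∧
    ∃ ε : ℕ → ℝ, Tendsto ε atTop (𝓝 0) ∧
      (∀ (n : ℕ) (M : Finset (QubitOp n)), (∀ P ∈ M, IsPauliObservable P) →
        (stabVectors M).Finite ∧
        ((stabVectors M).ncard : ℝ) ≤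
          (2 : ℝ) ^ (((min n M.card : ℕ) : ℝ) +
            min (Real.logb 2 3 / 3 * (M.card : ℝ)) ((1 / 2 + ε n) * (n : ℝ) ^ 2))) ∧
      (∀ n : ℕ,
        (∀ P ∈ localPaulis n, IsPauliObservable P) ∧
        (localPaulis n).card = 3 * n ∧
        ((stabVectors (localPaulis n)).ncard : ℝ) =
          (2 : ℝ) ^ ((n : ℝ) + Real.logb 2 3 / 3 * ((3 * n : ℕ) : ℝ)) ∧
        ((stabVectors (localPaulis n)).ncard : ℝ) =
          (2 : ℝ) ^ (((min n (localPaulis n).card : ℕ) : ℝ) +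
            min (Real.logb 2 3 / 3 * ((localPaulis n).card : ℝ))
              ((1 / 2 + ε n) * (n : ℝ) ^ 2))) := by
  refine ⟨fun n M hM => ⟨reducedPolytope_eq hM, extremePoints_reducedPolytope hM⟩,
    fun n => 2 / (n : ℝ), tendsto_const_div_atTop_nhds_zero_nat 2,
    fun n M hM => ⟨finite_stabVectors M, ncard_stabVectors_le_rpow hM⟩,
    fun n => ⟨fun P hP => isPauliObservable_of_mem_localPaulis hP, card_localPaulis n,
      ncard_stabVectors_localPaulis n, ?_⟩⟩
  rw [localPaulis_exponent_eq]
  exact ncard_stabVectors_localPaulis n
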